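/- Let $p\in\mathbb{N}_0$, $m\in\mathbb{N}_0$, $\alpha,\beta>0$, and let $\mathbf a=(a_1,\dots,a_p)$, $\mathbf b=(b_1,\dots,b_p)\in\mathbb{C}^p$ satisfy $$\Re(a_j)>0\quad(j=1,\dots,p),\qquad \Re\Bigl(\sum_{j=1}^p a_j\Bigr)<\Re\Bigl(\sum_{j=1}^p b_j\Bigr)+1 .$$ For a vector $\mathbf v\in\mathbb{C}^p$ and a number $\mu$ write $\mathbf v+\mu=(v_1+\mu,\dots,v_p+\mu)$ and $\Gamma(\mathbf v)=\Gamma(v_1)\cdots\Gamma(v_p)$, with the convention $1/\Gamma(-n)=0$ for $n\in\mathbb{N}_0$. For $0<x<1$ let $$G^{p,p}_{2p,2p}\left(x\,\middle|\,\begin{matrix}1-\mathbf a-m,\ \mathbf b+\alpha+\beta\\ \mathbf a+\alpha+\beta,\ 1-\mathbf b-m\end{matrix}\right)=\frac1{2\pi i}\int_L\frac{\Gamma(\mathbf a+\alpha+\beta-s)\,\Gamma(\mathbf a+m+s)}{\Gamma(\mathbf b+m+s)\,\Gamma(\mathbf b+\alpha+\beta-s)}\,x^s\,ds$$ be Meijer's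 $G$ function, where $L$ is a loop which begins and ends at $+\infty$ and encircles once, in the negative sense, all the poles of $\Gamma(a_j+\alpha+\beta-s)$, $j=1,\dots,p$, and none of the poles of $\Gamma(a_j+m+s)$, $j=1,\dots,p$. Then the integral on the right-hand side below converges absolutely, and $$\sum_{k=0}^{m}\left\{\frac{\Gamma(\mathbf a+k)\Gamma(\mathbf a+\alpha+\beta+m-k)}{\Gamma(\mathbf b+k)\Gamma(\mathbf b+\alpha+\beta+m-k)}-\frac{\Gamma(\mathbf a+\alpha+k)\Gamma(\mathbf a+\beta+m-k)}{\Gamma(\mathbf b+\alpha+k)\Gamma(\mathbf b+\beta+m-k)}\right\}$$ $$=\int_0^1 G^{p,p}_{2p,2p}\left(x\,\middle|\,\begin{matrix}1-\mathbf a-m,\ \mathbf b+\alpha+\beta\\ \mathbf a+\alpha+\beta,\ 1-\mathbf b-m\end{matrix}\right)\frac{(1-x^{m+1})(1-x^{\alpha})(1-x^{\beta})}{x^{\alpha+\beta+1}(1-x)}\,dx .$$ -/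

import Mathlib

noncomputable section

/-- The Mellin-Barnes integrand of Meijer's `G` function
`G^{m,n}_{p,q}(z | at, ab ; bt, bb)`, where `p = n + p'` and `q = m + q'`. The upper parameters are
`at` (the first `n`) and `ab` (the remaining `p'`), the lower parameters are `bt` (the first `m`)
and `bb` (the remaining `q'`). Since `Complex.Gamma` is `0` at its poles and `x / 0 = 0`, the
factors `1 / Γ` in the denominator vanish at the poles of `Γ`, as they should. -/
def meijerIntegrand {n p' m q' : ℕ} (at' : Fin n → ℂ) (ab : Fin p' → ℂ) (bt : Fin m → ℂ)
    (bb : Fin q' → ℂ) (z s : ℂ) : ℂ :=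
  ((∏ j, Complex.Gamma (bt j - s)) * ∏ j, Complex.Gamma (1 - at' j + s)) /
    ((∏ j, Complex.Gamma (1 - bb j + s)) * ∏ j, Complex.Gamma (ab j - s)) * z ^ s

/-- The integral of `F` along the loop which starts at `+∞ - iT`, runs left to `c - iT`, up to
`c + iT` and back right to `+∞ + iT`; it encircles the half-strip `Re s > c`, `|Im s| < T` once in
the negative (clockwise) sense. -/
def loopIntegral (F : ℂ → ℂ) (c T : ℝ) : ℂ :=
  -(∫ σ in Set.Ioi c, F ((σ : ℂ) - (T : ℂ) * Complex.I)) +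
    Complex.I * (∫ t in (-T)..T, F ((c : ℂ) + (t : ℂ) * Complex.I)) +
    ∫ σ in Set.Ioi c, F ((σ : ℂ) + (T : ℂ) * Complex.I)

/-- The loop with data `c`, `T` separates the two families of poles: all the poles `bt j + k`
(`k = 0, 1, …`) of the factors `Γ(bt j - s)` lie inside it, and all the poles `at j - 1 - k` of the
factors `Γ(1 - at j + s)` lie outside, to the left of it. -/
def IsSeparatingLoop {n m : ℕ} (at' : Fin n → ℂ) (bt : Fin m → ℂ) (c T : ℝ) : Prop :=
  0 < T ∧ (∀ j, c < (bt j).re ∧ |(bt j).im| < T) ∧ ∀ j, (at' j).re - 1 < c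

open Classical in
/-- Meijer's `G` function `G^{m,n}_{p,q}(z | at, ab ; bt, bb)`, with `p = n + p'` and `q = m + q'`,
as the Mellin-Barnes integral `(2πi)⁻¹ ∫_L` of its integrand over a loop `L` beginning and ending at
`+∞` and encircling the poles of all `Γ(bt j - s)` once in the negative sense, but none of the poles
of `Γ(1 - at j + s)`. This is the standard definition for `p < q` and all `z ≠ 0`, and for `p = q`
and `0 < |z| < 1`. By Cauchy's theorem the value does not depend on the loop. Rectangular loops are
used, so the parameters have to satisfy `Re (at i) - 1 < Re (bt j)` for all `i`, `j`; otherwise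
the value is the junk value `0`. -/
def meijerG {n p' m q' : ℕ} (at' : Fin n → ℂ) (ab : Fin p' → ℂ) (bt : Fin m → ℂ)
    (bb : Fin q' → ℂ) (z : ℂ) : ℂ :=
  if h : ∃ L : ℝ × ℝ, IsSeparatingLoop at' bt L.1 L.2 then
    (2 * (Real.pi : ℂ) * Complex.I)⁻¹ *
      loopIntegral (meijerIntegrand at' ab bt bb z) h.choose.1 h.choose.2
  else 0

/-- `Γ(v + μ) = Γ(v₁ + μ) ⋯ Γ(v_p + μ)` for a vector `v` and a number `μ`. -/
def gammaProd {p : ℕ} (v : Fin p → ℂ) (μ : ℂ) : ℂ :=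
  ∏ j, Complex.Gamma (v j + μ)

/-- The function `x ↦ G^{p,p}_{2p,2p}(x | 1-a-m, b+α+β ; a+α+β, 1-b-m) ·
(1-x^{m+1})(1-x^α)(1-x^β) / (x^{α+β+1}(1-x))`. -/
def gammaSumIntegrand {p : ℕ} (a b : Fin p → ℂ) (α β : ℝ) (m : ℕ) (x : ℝ) : ℂ :=
  meijerG (fun j => 1 - a j - m) (fun j => b j + α + β) (fun j => a j + α + β)
      (fun j => 1 - b j - m) (x : ℂ) *
    (((1 - x ^ (m + 1)) * (1 - x ^ α) * (1 - x ^ β) / (x ^ (α + β + 1) * (1 - x)) : ℝ) : ℂ)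

end

/-! Let `F` be the Gamma quotient in the Mellin-Barnes integral and `M(s) = ∫₀¹ x ^ s K(x) dx` the
Mellin transform of the remaining factor `K`. Expanding `K` in powers of `x` shows that `M` is
rational: it has residue `1` at `α + β - k` and `-k`, and residue `-1` at `α - k` and `β - k`, for
`0 ≤ k ≤ m`, added where these points coincide. Fubini (`path_integral_mul_gammaSumKernel`) turns
the right-hand side into `(2πi)⁻¹ ∫_L F M ds`, provided `L` lies in `Re s > α + β`.

The reflection `s ↦ α + β - m - s` fixes `F` and changes the sign of `M`. The rays of `L` can be
rotated to the vertical line `Re s = c`. By oddness the upward integral along the reflected line is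
the negative of the one along `Re s = c`, so the latter is half the boundary integral of the strip
between the lines. `F` is holomorphic there, so only the poles of `M` count, and the reflection
matches their residues in pairs. The two factors of two cancel and the finite sum remains
(`loopIntegral_gammaQuotientMulKernel`).

Convergence rests on two estimates. Away from the real axis `Γ(z) / Γ(z + w) = O(|z| ^ (-Re w))`,
also in the left half-plane, so `F = O(|s| ^ (2 Re(∑ a - ∑ b)))`. Cancellation in the partial
fractions gives `M = O(|s| ^ (-3))`. Hence `F M = O(|s| ^ (-q))`, and the hypothesis on `∑ a` and `∑
b` says exactly that `q > 1`. -/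

open Filter Topology

/-! ### Growth of `Γ(z) / Γ(z + w)` away from the real axis -/

/-- Shifting the index by `⌊Re z⌋` compares the terms with distinct terms of the series of `1 / (k ^
2 + 1)` over all integers, whose sum does not depend on `z`. -/
theorem exists_sum_inv_norm_add_natCast_sq_le {δ : ℝ} (hδ : 0 < δ) :
    ∃ C : ℝ, ∀ z : ℂ, δ ≤ |z.im| → ∀ n : ℕ, ∑ j ∈ Finset.range n, 1 / ‖z + j‖ ^ 2 ≤ C := by
  have hs : Summable fun k : ℤ => 1 / ((k : ℝ) ^ 2 + 1) := by
    -- The indicator of `0` dominates the term `k = 0`, where `1 / k ^ 2` has the default value `0`.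
    refine Summable.of_nonneg_of_le (fun k => by positivity) (fun k => ?_)
      (((Real.summable_one_div_int_pow (p := 2)).2 (by norm_num)).add
        (summable_of_ne_finset_zero (s := {0}) (f := fun k : ℤ => if k = 0 then (1 : ℝ) else 0)
          (by simp)))
    by_cases hk : k = 0
    · simp [hk]
    · have : (0 : ℝ) < (k : ℝ) ^ 2 := by positivity
      simp only [hk, if_false, add_zero]
      gcongr
      linarith
  refine ⟨(2 + 3 / δ ^ 2) * ∑' k : ℤ, 1 / ((k : ℝ) ^ 2 + 1), fun z hz n => ?_⟩
  have key : ∀ j : ℕ, 1 / ‖z + j‖ ^ 2 ≤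
      (2 + 3 / δ ^ 2) * (1 / (((⌊z.re⌋ + (j : ℤ) : ℤ) : ℝ) ^ 2 + 1)) := by
    intro j
    have h1 : ‖z + j‖ ^ 2 = (z.re + j) ^ 2 + z.im ^ 2 := by
      rw [Complex.sq_norm, Complex.normSq_apply]; simp; ring
    have h2 : δ ^ 2 ≤ z.im ^ 2 := by
      rw [← sq_abs z.im]; gcongr
    have hδ2 : 0 < δ ^ 2 := by positivity
    have hp : 0 < (z.re + j) ^ 2 + z.im ^ 2 := by linarith [sq_nonneg (z.re + j)]
    rw [h1, mul_one_div, div_le_div_iff₀ hp (by positivity), one_mul]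
    have h3 : z.re = ⌊z.re⌋ + Int.fract z.re := (Int.floor_add_fract _).symm
    have h4 := Int.fract_nonneg z.re
    have h5 := (Int.fract_lt_one z.re).le
    set f := Int.fract z.re
    push_cast
    set k : ℝ := (⌊z.re⌋ : ℝ) + j
    have h6 : z.re + j = k + f := by rw [h3]; simp only [k]; ring
    rw [h6]
    -- The difference of the two sides is `(k + 2f) ^ 2 + 2 (1 - f ^ 2)`.
    have h7 : k ^ 2 + 1 ≤ 2 * (k + f) ^ 2 + 3 := by nlinarith [sq_nonneg (k + 2 * f)]
    have h8 : 3 ≤ 3 / δ ^ 2 * z.im ^ 2 := by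
      rw [div_mul_eq_mul_div, le_div_iff₀ hδ2]; linarith
    have h9 : 0 ≤ 3 / δ ^ 2 * (k + f) ^ 2 := by positivity
    nlinarith [sq_nonneg z.im]
  refine (Finset.sum_le_sum fun j _ => key j).trans ?_
  rw [← Finset.mul_sum]
  gcongr
  have hinj : Function.Injective fun j : ℕ => ⌊z.re⌋ + (j : ℤ) := fun i j h => by simpa using h
  have := Summable.sum_le_tsum ((Finset.range n).map ⟨_, hinj⟩)
    (fun (i : ℤ) _ => (by positivity : (0 : ℝ) ≤ 1 / ((i : ℝ) ^ 2 + 1))) hs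
  simpa only [Finset.sum_map, Function.Embedding.coeFn_mk] using this

theorem norm_le_mul_norm_add_of_le_abs_im {δ : ℝ} (hδ : 0 < δ) {z u : ℂ} (h : δ ≤ |(z + u).im|) :
    ‖z‖ ≤ (1 + ‖u‖ / δ) * ‖z + u‖ := by
  have h1 : δ ≤ ‖z + u‖ := h.trans (Complex.abs_im_le_norm _)
  have h2 : ‖z‖ ≤ ‖z + u‖ + ‖u‖ := by simpa using norm_sub_le (z + u) u
  have h3 : ‖u‖ ≤ ‖u‖ / δ * ‖z + u‖ := by
    rw [div_mul_eq_mul_div, le_div_iff₀ hδ]; gcongr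
  linarith

/-- Mean value inequality for `t / z - log (z + t)` on `[0, 1]`: its derivative is `t / (z (z +
t))`, and the segment stays off the branch cut because its imaginary part is constant and nonzero.
-/
theorem norm_log_add_one_sub_log_sub_inv_le {δ : ℝ} (hδ : 0 < δ) {z : ℂ} (hz : δ ≤ |z.im|) :
    ‖1 / z - (Complex.log (z + 1) - Complex.log z)‖ ≤ (1 + 1 / δ) * (1 / ‖z‖ ^ 2) := by
  have him : ∀ t : ℝ, (z + t).im = z.im := by simp
  have hne : ∀ t : ℝ, z + t ≠ 0 := fun t h => by
    have := congrArg Complex.im h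
    rw [him, Complex.zero_im] at this
    rw [this, abs_zero] at hz; linarith
  have hslit : ∀ t : ℝ, z + t ∈ Complex.slitPlane := fun t => by
    right; rw [him]; intro h; rw [h, abs_zero] at hz; linarith
  have hz0 : z ≠ 0 := by simpa using hne 0
  have hzpos : 0 < ‖z‖ := norm_pos_iff.2 hz0
  have hd : ∀ t ∈ Set.Icc (0 : ℝ) 1, HasDerivWithinAt
      (fun t : ℝ => t / z - Complex.log (z + t)) (1 / z - 1 / (z + t)) (Set.Icc 0 1) t := by
    intro t _
    have h1 : HasDerivAt (fun t : ℝ => z + (t : ℂ)) 1 t :=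
      (Complex.ofRealCLM.hasDerivAt (x := t)).const_add z
    have h2 : HasDerivAt (fun t : ℝ => (t : ℂ) / z) (1 / z) t :=
      (Complex.ofRealCLM.hasDerivAt (x := t)).div_const z
    exact (h2.sub (h1.clog_real (hslit t))).hasDerivWithinAt
  have := norm_image_sub_le_of_norm_deriv_le_segment_01' hd
    (C := (1 + 1 / δ) * (1 / ‖z‖ ^ 2)) (fun t ht => by
      have e : 1 / z - 1 / (z + t) = t / (z * (z + t)) := by
        field_simp [hz0, hne t]; ring
      have hle : ‖z‖ ≤ (1 + 1 / δ) * ‖z + t‖ := by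
        have h1 := norm_le_mul_norm_add_of_le_abs_im hδ (z := z) (u := t) (by rwa [him])
        have h2 : ‖(t : ℂ)‖ ≤ 1 := by
          rw [Complex.norm_real, Real.norm_eq_abs, abs_of_nonneg ht.1]; exact ht.2.le
        refine h1.trans ?_
        gcongr
      have hp : 0 < ‖z + t‖ := norm_pos_iff.2 (hne t)
      rw [e, norm_div, norm_mul, Complex.norm_real, Real.norm_eq_abs, abs_of_nonneg ht.1,
        mul_one_div, div_le_div_iff₀ (by positivity) (by positivity)]
      calc t * ‖z‖ ^ 2 ≤ 1 * ‖z‖ ^ 2 := by have := ht.2.le; gcongr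
        _ = ‖z‖ * ‖z‖ := by ring
        _ ≤ ‖z‖ * ((1 + 1 / δ) * ‖z + t‖) := by gcongr
        _ = _ := by ring)
  refine le_trans (le_of_eq ?_) this
  congr 1
  simp
  ring

/-- Apply `1 + x ≤ exp x` to `‖1 + w‖ ^ 2 = 1 + 2 Re w + ‖w‖ ^ 2`. No smallness of `w` is needed, so
every factor of the Euler product can be treated alike. -/
theorem norm_one_add_le_exp (w : ℂ) : ‖1 + w‖ ≤ Real.exp (w.re + ‖w‖ ^ 2 / 2) := by
  have h : ‖1 + w‖ ^ 2 ≤ Real.exp (w.re + ‖w‖ ^ 2 / 2) ^ 2 := by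
    rw [← Real.exp_nat_mul]
    have h1 : ‖1 + w‖ ^ 2 = 2 * w.re + ‖w‖ ^ 2 + 1 := by
      simp only [Complex.sq_norm, Complex.normSq_apply, Complex.add_re, Complex.add_im,
        Complex.one_re, Complex.one_im]
      ring
    rw [h1]
    refine (Real.add_one_le_exp _).trans (le_of_eq ?_)
    push_cast; ring_nf
  exact le_of_sq_le_sq h (Real.exp_pos _).le

theorem Complex.GammaSeq_div_GammaSeq_add (z w : ℂ) (hz : ∀ j : ℕ, z + j ≠ 0) {n : ℕ} (hn : n ≠ 0) :
    Complex.GammaSeq z n / Complex.GammaSeq (z + w) n =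
      (n : ℂ) ^ (-w) * ∏ j ∈ Finset.range (n + 1), (1 + w / (z + j)) := by
  have h1 : ∏ j ∈ Finset.range (n + 1), (1 + w / (z + j)) =
      (∏ j ∈ Finset.range (n + 1), (z + w + j)) / ∏ j ∈ Finset.range (n + 1), (z + j) := by
    rw [← Finset.prod_div_distrib]
    refine Finset.prod_congr rfl fun j _ => ?_
    field_simp [hz j]; ring
  have hn' : (n : ℂ) ≠ 0 := by exact_mod_cast hn
  have hf : ((n.factorial : ℕ) : ℂ) ≠ 0 := by exact_mod_cast n.factorial_ne_zero
  have hc : (n : ℂ) ^ z ≠ 0 := by simp [Complex.cpow_eq_zero_iff, hn']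
  have hc' : (n : ℂ) ^ w ≠ 0 := by simp [Complex.cpow_eq_zero_iff, hn']
  rw [h1, Complex.GammaSeq, Complex.GammaSeq, Complex.cpow_add _ _ hn', Complex.cpow_neg,
    div_div_div_eq]
  field_simp

/-- In the region `|Im z| ≥ δ` the quotient `Γ(z) / Γ(z + w)` is `O(|z| ^ (-Re w))`. -/
theorem Complex.exists_norm_Gamma_div_Gamma_add_le {δ : ℝ} (hδ : 0 < δ) (w : ℂ) :
    ∃ C : ℝ, 0 ≤ C ∧ ∀ z : ℂ, δ ≤ |z.im| →
      ‖Complex.Gamma z / Complex.Gamma (z + w)‖ ≤ C * ‖z‖ ^ (-w.re) := by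
  obtain ⟨S, hS⟩ := exists_sum_inv_norm_add_natCast_sq_le hδ
  set D : ℝ := (‖w‖ ^ 2 / 2 + ‖w‖ * (1 + 1 / δ)) * S + 2 * Real.pi * |w.im| with hD
  refine ⟨Real.exp D, (Real.exp_pos _).le, fun z hz => ?_⟩
  -- At a pole of `Γ(z + w)` the quotient is `0` by convention; elsewhere it is the limit of the
  -- quotients of `GammaSeq`.
  by_cases hG : Complex.Gamma (z + w) = 0
  · rw [hG, div_zero, norm_zero]; positivity
  have him : ∀ j : ℕ, (z + j).im = z.im := by simp
  have hne : ∀ j : ℕ, z + j ≠ 0 := fun j h => by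
    have := congrArg Complex.im h
    rw [him, Complex.zero_im] at this
    rw [this, abs_zero] at hz; linarith
  have hz0 : 0 < ‖z‖ := norm_pos_iff.2 (by simpa using hne 0)
  have hlim := ((Complex.GammaSeq_tendsto_Gamma z).div (Complex.GammaSeq_tendsto_Gamma (z + w))
    hG).norm
  have hratio : Tendsto (fun n : ℕ => ‖z + (n + 1 : ℕ)‖ / n) atTop (𝓝 1) := by
    have h1 : Tendsto (fun n : ℕ => ‖(z + 1) / (n : ℂ) + 1‖) atTop (𝓝 ‖(0 : ℂ) + 1‖) := by
      refine (Tendsto.add ?_ tendsto_const_nhds).norm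
      simpa [div_eq_mul_inv] using
        (tendsto_inv_atTop_nhds_zero_nat (𝕜 := ℂ)).const_mul (z + 1)
    rw [zero_add, norm_one] at h1
    refine h1.congr' ?_
    filter_upwards [eventually_ne_atTop 0] with n hn
    have hn' : (n : ℂ) ≠ 0 := by exact_mod_cast hn
    rw [← Complex.norm_natCast n, ← norm_div]
    congr 1
    field_simp
    push_cast; ring
  have hlim2 : Tendsto (fun n : ℕ => Real.exp (D + w.re * Real.log (‖z + (n + 1 : ℕ)‖ / n) -
      w.re * Real.log ‖z‖)) atTop (𝓝 (Real.exp D * ‖z‖ ^ (-w.re))) := by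
    have h1 : Real.exp D * ‖z‖ ^ (-w.re) =
        Real.exp (D + w.re * Real.log 1 - w.re * Real.log ‖z‖) := by
      rw [Real.rpow_def_of_pos hz0, ← Real.exp_add, Real.log_one]; congr 1; ring
    rw [h1]
    exact (Real.continuous_exp.tendsto _).comp (((hratio.log one_ne_zero).const_mul _).const_add _
      |>.sub_const _)
  refine le_of_tendsto_of_tendsto hlim hlim2 ?_
  filter_upwards [eventually_ne_atTop 0] with n hn
  have hn0 : (0 : ℝ) < n := by exact_mod_cast Nat.pos_of_ne_zero hn
  simp only [Pi.div_apply]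
  rw [Complex.GammaSeq_div_GammaSeq_add z w hne hn, norm_mul, norm_prod,
    Complex.norm_natCast_cpow_of_pos (Nat.pos_of_ne_zero hn)]
  -- Replacing `1 / (z + j)` by a difference of logarithms makes the main term telescope; the errors
  -- are summable uniformly in `z`.
  have hlog : ∑ j ∈ Finset.range (n + 1), (Complex.log (z + j + 1) - Complex.log (z + j)) =
      Complex.log (z + (n + 1 : ℕ)) - Complex.log z := by
    have := Finset.sum_range_sub (fun j : ℕ => Complex.log (z + j)) (n + 1)
    simp only [Nat.cast_zero, add_zero] at this
    rw [← this]
    refine Finset.sum_congr rfl fun j _ => ?_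
    push_cast; ring_nf
  have hstep : ∀ j : ℕ, ‖1 + w / (z + j)‖ ≤
      Real.exp ((w * (Complex.log (z + j + 1) - Complex.log (z + j))).re +
        (‖w‖ ^ 2 / 2 + ‖w‖ * (1 + 1 / δ)) * (1 / ‖z + j‖ ^ 2)) := by
    intro j
    refine (norm_one_add_le_exp _).trans (Real.exp_le_exp.2 ?_)
    have h1 := norm_log_add_one_sub_log_sub_inv_le hδ (z := z + j) (by rwa [him])
    have h2 : (w / (z + j)).re = (w * (Complex.log (z + j + 1) - Complex.log (z + j))).re +
        (w * (1 / (z + j) - (Complex.log (z + j + 1) - Complex.log (z + j)))).re := by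
      rw [← Complex.add_re]; congr 1; ring
    have h3 := (Complex.re_le_norm
      (w * (1 / (z + j) - (Complex.log (z + j + 1) - Complex.log (z + j))))).trans
        (norm_mul_le _ _)
    have h4 := mul_le_mul_of_nonneg_left h1 (norm_nonneg w)
    rw [h2, norm_div, div_pow]
    have e : (‖w‖ ^ 2 / 2 + ‖w‖ * (1 + 1 / δ)) * (1 / ‖z + j‖ ^ 2) =
      ‖w‖ * ((1 + 1 / δ) * (1 / ‖z + j‖ ^ 2)) + ‖w‖ ^ 2 / ‖z + j‖ ^ 2 / 2 := by ring
    rw [e]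
    linarith
  have hprod := Finset.prod_le_prod (s := Finset.range (n + 1)) (fun j _ => norm_nonneg _)
    (fun j _ => hstep j)
  rw [← Real.exp_sum, Finset.sum_add_distrib, ← Finset.mul_sum, ← Complex.re_sum,
    ← Finset.mul_sum, hlog] at hprod
  have hnpow : (n : ℝ) ^ (-w).re = Real.exp (-(w.re * Real.log n)) := by
    rw [Real.rpow_def_of_pos hn0]; congr 1; simp; ring
  rw [hnpow]
  refine (mul_le_mul_of_nonneg_left hprod (Real.exp_pos _).le).trans ?_
  rw [← Real.exp_add, Real.exp_le_exp]
  have h5 : (w * (Complex.log (z + (n + 1 : ℕ)) - Complex.log z)).re =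
      w.re * (Real.log ‖z + (n + 1 : ℕ)‖ - Real.log ‖z‖) -
        w.im * (Complex.arg (z + (n + 1 : ℕ)) - Complex.arg z) := by
    simp [Complex.mul_re, Complex.log_re, Complex.log_im]
  have hp1 : 0 < ‖z + (n + 1 : ℕ)‖ := norm_pos_iff.2 (hne _)
  rw [h5, Real.log_div hp1.ne' hn0.ne']
  -- Both arguments are at most `π` in absolute value, so `Im w` costs only a constant factor.
  have h6 : -(w.im * (Complex.arg (z + (n + 1 : ℕ)) - Complex.arg z)) ≤ 2 * Real.pi * |w.im| := by
    refine (neg_le_abs _).trans ?_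
    rw [abs_mul, mul_comm]
    gcongr
    have := abs_sub (Complex.arg (z + (n + 1 : ℕ))) (Complex.arg z)
    linarith [Complex.abs_arg_le_pi (z + (n + 1 : ℕ)), Complex.abs_arg_le_pi z]
  have h7 : (‖w‖ ^ 2 / 2 + ‖w‖ * (1 + 1 / δ)) *
      ∑ j ∈ Finset.range (n + 1), 1 / ‖z + j‖ ^ 2 ≤ (‖w‖ ^ 2 / 2 + ‖w‖ * (1 + 1 / δ)) * S := by
    gcongr
    exact hS z hz _
  rw [hD]
  linarith

/-! ### The Gamma quotient: reflection, growth, holomorphy -/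

/-- The quotient of products of Gamma functions
`Γ(a + u - s) Γ(a + v + s) / (Γ(b + v + s) Γ(b + u - s))`. -/
noncomputable def gammaQuotient {p : ℕ} (a b : Fin p → ℂ) (u v : ℝ) (s : ℂ) : ℂ :=
  gammaProd a (u - s) * gammaProd a (v + s) / (gammaProd b (v + s) * gammaProd b (u - s))

theorem gammaQuotient_reflect {p : ℕ} (a b : Fin p → ℂ) (u v : ℝ) (s : ℂ) :
    gammaQuotient a b u v (u - v - s) = gammaQuotient a b u v s := by
  have h1 : (u : ℂ) - (u - v - s) = v + s := by ring
  have h2 : (v : ℂ) + (u - v - s) = u - s := by ring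
  rw [gammaQuotient, gammaQuotient, h1, h2, mul_comm (gammaProd a _), mul_comm (gammaProd b _)]

theorem gammaQuotient_eq_prod {p : ℕ} (a b : Fin p → ℂ) (u v : ℝ) (s : ℂ) :
    gammaQuotient a b u v s =
      ∏ j, (Complex.Gamma (a j + (u - s)) / Complex.Gamma (a j + (u - s) + (b j - a j))) *
        (Complex.Gamma (a j + (v + s)) / Complex.Gamma (a j + (v + s) + (b j - a j))) := by
  simp only [gammaQuotient, gammaProd]
  rw [mul_comm (∏ j, Complex.Gamma (b j + (v + s))), mul_div_mul_comm, ← Finset.prod_div_distrib,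
    ← Finset.prod_div_distrib, ← Finset.prod_mul_distrib]
  refine Finset.prod_congr rfl fun j _ => ?_
  congr 3 <;> ring_nf

theorem Real.rpow_le_mul_rpow_of_le_mul {x y M : ℝ} (hx : 0 < x) (hy : 0 < y) (hM : 0 < M)
    (hxy : x ≤ M * y) (hyx : y ≤ M * x) (e : ℝ) : x ^ e ≤ M ^ |e| * y ^ e := by
  rcases le_total 0 e with he | he
  · rw [abs_of_nonneg he, ← Real.mul_rpow hM.le hy.le]
    exact Real.rpow_le_rpow hx.le hxy he
  · rw [abs_of_nonpos he, Real.rpow_neg hM.le, ← Real.inv_rpow hM.le,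
      ← Real.mul_rpow (inv_pos.2 hM).le hy.le]
    refine Real.rpow_le_rpow_of_nonpos (by positivity) ?_ he
    rw [inv_mul_le_iff₀ hM]; exact hyx

theorem norm_add_rpow_le {T δ : ℝ} (hT : 0 < T) (hδ : 0 < δ) (u : ℂ) (e : ℝ) :
    ∃ C : ℝ, 0 ≤ C ∧ ∀ s : ℂ, T ≤ |s.im| → δ ≤ |(s + u).im| → ‖s + u‖ ^ e ≤ C * ‖s‖ ^ e := by
  set M := (1 + ‖u‖ / T) + (1 + ‖u‖ / δ)
  have hM : 0 < M := by positivity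
  refine ⟨M ^ |e|, by positivity, fun s hs hsu => ?_⟩
  have hs0 : 0 < ‖s‖ := hT.trans_le (hs.trans (Complex.abs_im_le_norm s))
  have hsu0 : 0 < ‖s + u‖ := hδ.trans_le (hsu.trans (Complex.abs_im_le_norm _))
  have h1 := norm_le_mul_norm_add_of_le_abs_im hδ hsu
  have h2 := norm_le_mul_norm_add_of_le_abs_im (z := s + u) (u := -u) hT (by simpa using hs)
  rw [norm_neg, add_neg_cancel_right] at h2
  refine Real.rpow_le_mul_rpow_of_le_mul hsu0 hs0 hM ?_ ?_ e
  · refine h2.trans ?_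
    gcongr
    exact le_add_of_nonneg_right (by positivity)
  · refine h1.trans ?_
    gcongr
    exact le_add_of_nonneg_left (by positivity)

/-- Each index contributes two quotients `Γ(z) / Γ(z + w)` with the same `w = b j - a j`, whence the
factor `2` in the exponent. The condition on `Im (a j)` keeps both arguments at distance at least `T
- |Im (a j)|` from the real axis. -/
theorem exists_norm_gammaQuotient_le {p : ℕ} (a b : Fin p → ℂ) (u v : ℝ) {T : ℝ} (hT : 0 < T)
    (ha : ∀ j, |(a j).im| < T) :
    ∃ C : ℝ, 0 ≤ C ∧ ∀ s : ℂ, T ≤ |s.im| →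
      ‖gammaQuotient a b u v s‖ ≤ C * ‖s‖ ^ (2 * ((∑ j, a j).re - (∑ j, b j).re)) := by
  have key : ∀ j, ∃ C : ℝ, 0 ≤ C ∧ ∀ s : ℂ, T ≤ |s.im| →
      ‖(Complex.Gamma (a j + (u - s)) / Complex.Gamma (a j + (u - s) + (b j - a j))) *
        (Complex.Gamma (a j + (v + s)) / Complex.Gamma (a j + (v + s) + (b j - a j)))‖ ≤
        C * ‖s‖ ^ (2 * ((a j).re - (b j).re)) := by
    intro j
    have hδ : 0 < T - |(a j).im| := sub_pos.2 (ha j)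
    obtain ⟨C, hC0, hC⟩ := Complex.exists_norm_Gamma_div_Gamma_add_le hδ (b j - a j)
    obtain ⟨C₁, hC₁, h₁⟩ := norm_add_rpow_le hT hδ (-(a j + u)) (-(b j - a j).re)
    obtain ⟨C₂, hC₂, h₂⟩ := norm_add_rpow_le hT hδ (a j + v) (-(b j - a j).re)
    refine ⟨(C * C₁) * (C * C₂), by positivity, fun s hs => ?_⟩
    have hs0 : 0 < ‖s‖ := hT.trans_le (hs.trans (Complex.abs_im_le_norm s))
    have e1 : a j + (u - s) = -(s + -(a j + u)) := by ring
    have e2 : a j + (v + s) = s + (a j + v) := by ring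
    have i1 : T - |(a j).im| ≤ |(s + -(a j + u)).im| := by
      have := abs_sub_abs_le_abs_sub s.im (a j).im
      have e : (s + -(a j + u)).im = s.im - (a j).im := by simp; ring
      rw [e]; linarith
    have i2 : T - |(a j).im| ≤ |(s + (a j + v)).im| := by
      have := abs_sub_abs_le_abs_sub s.im (-(a j).im)
      have e : (s + (a j + v)).im = s.im - -(a j).im := by simp
      rw [e]; rw [abs_neg] at this; linarith
    have b1 := hC (a j + (u - s)) (by rw [e1, Complex.neg_im, abs_neg]; exact i1)
    have b2 := hC (a j + (v + s)) (by rw [e2]; exact i2)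
    rw [norm_mul]
    have e3 : ‖a j + (u - s)‖ = ‖s + -(a j + u)‖ := by rw [e1, norm_neg]
    have e4 : ‖a j + (v + s)‖ = ‖s + (a j + v)‖ := by rw [e2]
    rw [e3] at b1
    rw [e4] at b2
    have b1' := b1.trans (mul_le_mul_of_nonneg_left (h₁ s hs i1) hC0)
    have b2' := b2.trans (mul_le_mul_of_nonneg_left (h₂ s hs i2) hC0)
    refine (mul_le_mul b1' b2' (norm_nonneg _) (by positivity)).trans (le_of_eq ?_)
    have e5 : 2 * ((a j).re - (b j).re) = -(b j - a j).re + -(b j - a j).re := by simp; ring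
    rw [e5, Real.rpow_add hs0]
    ring
  choose C hC0 hC using key
  refine ⟨∏ j, C j, Finset.prod_nonneg fun j _ => hC0 j, fun s hs => ?_⟩
  have hs0 : 0 < ‖s‖ := hT.trans_le (hs.trans (Complex.abs_im_le_norm s))
  rw [gammaQuotient_eq_prod, norm_prod]
  refine (Finset.prod_le_prod (fun j _ => norm_nonneg _) fun j _ => hC j s hs).trans
    (le_of_eq ?_)
  rw [Finset.prod_mul_distrib, ← Real.rpow_sum_of_pos hs0, ← Finset.mul_sum,
    Finset.sum_sub_distrib, Complex.re_sum, Complex.re_sum]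

/-- The poles in question are `a j + u + k` and `-(a j + v + k)`. The first alternative avoids them
by imaginary parts, the second by real parts. Since `1 / Γ` is entire, `b` is unrestricted. -/
theorem differentiableAt_gammaQuotient {p : ℕ} {a b : Fin p → ℂ} {u v : ℝ} {s : ℂ}
    (h : ∀ j, |(a j).im| < |s.im| ∨ s.re < u + (a j).re ∧ -(v + (a j).re) < s.re) :
    DifferentiableAt ℂ (gammaQuotient a b u v) s := by
  have h1 : ∀ j, DifferentiableAt ℂ (fun s => Complex.Gamma (a j + (u - s))) s := by
    intro j
    refine DifferentiableAt.comp s (f := fun s => a j + (u - s))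
      (Complex.differentiableAt_Gamma _ fun k hk => ?_) (by fun_prop)
    have hre := congrArg Complex.re hk
    have him := congrArg Complex.im hk
    simp at hre him
    rcases h j with h | h
    · rw [show s.im = (a j).im by linarith] at h; exact lt_irrefl _ h
    · have : (0 : ℝ) ≤ k := k.cast_nonneg
      linarith
  have h2 : ∀ j, DifferentiableAt ℂ (fun s => Complex.Gamma (a j + (v + s))) s := by
    intro j
    refine DifferentiableAt.comp s (f := fun s => a j + (v + s))
      (Complex.differentiableAt_Gamma _ fun k hk => ?_) (by fun_prop)
    have hre := congrArg Complex.re hk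
    have him := congrArg Complex.im hk
    simp at hre him
    rcases h j with h | h
    · rw [show s.im = -(a j).im by linarith, abs_neg] at h; exact lt_irrefl _ h
    · have : (0 : ℝ) ≤ k := k.cast_nonneg
      linarith
  have h3 : ∀ g : Fin p → ℂ → ℂ, (∀ j, Differentiable ℂ (g j)) →
      DifferentiableAt ℂ (fun s => (∏ j, Complex.Gamma (g j s))⁻¹) s := by
    intro g hg
    simp only [← Finset.prod_inv_distrib]
    exact DifferentiableAt.fun_finsetProd fun j _ =>
      (Complex.differentiable_one_div_Gamma.comp (hg j)).differentiableAt
  have h4 : gammaQuotient a b u v = fun s =>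
      ((∏ j, Complex.Gamma (a j + (u - s))) * ∏ j, Complex.Gamma (a j + (v + s))) *
        ((∏ j, Complex.Gamma (b j + (v + s)))⁻¹ * (∏ j, Complex.Gamma (b j + (u - s)))⁻¹) := by
    funext s
    rw [gammaQuotient, div_eq_mul_inv, mul_inv]; rfl
  rw [h4]
  exact ((DifferentiableAt.fun_finsetProd fun j _ => h1 j).mul
    (DifferentiableAt.fun_finsetProd fun j _ => h2 j)).mul
      ((h3 _ fun j => by fun_prop).mul (h3 _ fun j => by fun_prop))

/-! ### The rational Mellin transform and its cubic decay -/

/-- The Mellin transform `∫₀¹ x ^ s K(x) dx` of the kernel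
`K(x) = (1 - x ^ (m + 1)) (1 - x ^ α) (1 - x ^ β) / (x ^ (α + β + 1) (1 - x))`. -/
noncomputable def kernelMellin (α β : ℝ) (m : ℕ) (s : ℂ) : ℂ :=
  ∑ k ∈ Finset.range (m + 1), (1 / (s - (α + β - k)) + 1 / (s - -k) -
    1 / (s - (α - k)) - 1 / (s - (β - k)))

theorem kernelMellin_reflect (α β : ℝ) (m : ℕ) (s : ℂ) :
    kernelMellin α β m ((α + β : ℝ) - m - s) = -kernelMellin α β m s := by
  rw [kernelMellin, kernelMellin, ← Finset.sum_range_reflect, ← Finset.sum_neg_distrib]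
  refine Finset.sum_congr rfl fun k hk => ?_
  have hk' : k ≤ m := Nat.lt_succ_iff.1 (Finset.mem_range.1 hk)
  rw [Nat.add_sub_cancel, Nat.cast_sub hk']
  push_cast
  have e1 : (α + β - m - s - (α + β - (m - k)) : ℂ) = -(s - -k) := by ring
  have e2 : (α + β - m - s - -(m - k) : ℂ) = -(s - (α + β - k)) := by ring
  have e3 : (α + β - m - s - (α - (m - k)) : ℂ) = -(s - (β - k)) := by ring
  have e4 : (α + β - m - s - (β - (m - k)) : ℂ) = -(s - (α - k)) := by ring
  rw [e1, e2, e3, e4]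
  simp only [one_div, inv_neg]
  ring

/-- With equal sums, the combination factors through `z₃ * z₄ - z₁ * z₂`. In the application this is
the constant `α * β`, so two orders of decay are gained over a single fraction. -/
theorem norm_second_difference_inv_le {z₁ z₂ z₃ z₄ : ℂ} {r A : ℝ} (hr : 0 < r)
    (h₁ : r ≤ ‖z₁‖) (h₂ : r ≤ ‖z₂‖) (h₃ : r ≤ ‖z₃‖) (h₄ : r ≤ ‖z₄‖)
    (h : z₁ + z₂ = z₃ + z₄) (hA : ‖z₃ * z₄ - z₁ * z₂‖ ≤ A) :
    ‖1 / z₁ + 1 / z₂ - 1 / z₃ - 1 / z₄‖ ≤ 2 * A / r ^ 3 := by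
  have n₁ : z₁ ≠ 0 := norm_pos_iff.1 (hr.trans_le h₁)
  have n₂ : z₂ ≠ 0 := norm_pos_iff.1 (hr.trans_le h₂)
  have n₃ : z₃ ≠ 0 := norm_pos_iff.1 (hr.trans_le h₃)
  have n₄ : z₄ ≠ 0 := norm_pos_iff.1 (hr.trans_le h₄)
  have e : 1 / z₁ + 1 / z₂ - 1 / z₃ - 1 / z₄ =
      (z₃ * z₄ - z₁ * z₂) * (1 / (z₂ * z₃ * z₄) + 1 / (z₁ * z₃ * z₄)) := by
    have : z₄ = z₁ + z₂ - z₃ := by rw [h]; ring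
    field_simp
    rw [this]; ring
  have bd : ∀ x y z : ℂ, r ≤ ‖x‖ → r ≤ ‖y‖ → r ≤ ‖z‖ → ‖1 / (x * y * z)‖ ≤ 1 / r ^ 3 := by
    intro x y z hx hy hz
    rw [norm_div, norm_one, norm_mul, norm_mul]
    have : r ^ 3 = r * r * r := by ring
    rw [this]
    gcongr
  rw [e, norm_mul]
  have hA0 : 0 ≤ A := (norm_nonneg _).trans hA
  calc _ ≤ A * (1 / r ^ 3 + 1 / r ^ 3) := by
        gcongr
        exact (norm_add_le _ _).trans (add_le_add (bd _ _ _ h₂ h₃ h₄) (bd _ _ _ h₁ h₃ h₄))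
    _ = _ := by ring

/-- All poles are real and lie in `[-m, α + β]`. Comparability of `‖s‖` with the distance to that
segment holds both away from the real axis and on a real ray to the right of the poles; both cases
are needed. -/
theorem exists_norm_kernelMellin_le {α β : ℝ} (hα : 0 < α) (hβ : 0 < β) (m : ℕ) {M : ℝ}
    (hM : 0 < M) :
    ∃ C : ℝ, 0 ≤ C ∧ ∀ s : ℂ, s ≠ 0 →
      (∀ r : ℝ, -m ≤ r → r ≤ α + β → ‖s‖ ≤ M * ‖s - r‖) →
      ‖kernelMellin α β m s‖ ≤ C * ‖s‖ ^ (-3 : ℝ) := by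
  refine ⟨(m + 1 : ℕ) * (2 * (α * β) * M ^ 3), by positivity, fun s hs h => ?_⟩
  have hs0 : 0 < ‖s‖ := norm_pos_iff.2 hs
  have hr : ∀ r : ℝ, -m ≤ r → r ≤ α + β → ‖s‖ / M ≤ ‖s - r‖ := fun r h1 h2 => by
    rw [div_le_iff₀ hM, mul_comm]; exact h r h1 h2
  rw [kernelMellin]
  refine (norm_sum_le _ _).trans ?_
  have hterm : ∀ k ∈ Finset.range (m + 1), ‖1 / (s - (α + β - k)) + 1 / (s - -k) -
      1 / (s - (α - k)) - 1 / (s - (β - k))‖ ≤ 2 * (α * β) * M ^ 3 * ‖s‖ ^ (-3 : ℝ) := by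
    intro k hk
    have hk' : (k : ℝ) ≤ m := by exact_mod_cast Nat.lt_succ_iff.1 (Finset.mem_range.1 hk)
    have hk0 : (0 : ℝ) ≤ k := k.cast_nonneg
    have h1 := hr (α + β - k) (by linarith) (by linarith)
    have h2 := hr (-k) (by linarith) (by linarith)
    have h3 := hr (α - k) (by linarith) (by linarith)
    have h4 := hr (β - k) (by linarith) (by linarith)
    push_cast at h1 h2 h3 h4
    refine (norm_second_difference_inv_le (A := α * β) (by positivity) h1 h2 h3 h4
      (by ring) (le_of_eq ?_)).trans (le_of_eq ?_)
    · have e : (s - (α - k)) * (s - (β - k)) - (s - (α + β - k)) * (s - -k) =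
          ((α * β : ℝ) : ℂ) := by push_cast; ring
      rw [e, Complex.norm_real, Real.norm_eq_abs, abs_of_pos (by positivity)]
    · rw [Real.rpow_neg hs0.le, show (3 : ℝ) = (3 : ℕ) by norm_num, Real.rpow_natCast]
      field_simp
  refine (Finset.sum_le_card_nsmul _ _ _ hterm).trans (le_of_eq ?_)
  rw [Finset.card_range, nsmul_eq_mul]; ring

theorem exists_norm_kernelMellin_le_of_le_abs_im {α β : ℝ} (hα : 0 < α) (hβ : 0 < β) (m : ℕ)
    {T : ℝ} (hT : 0 < T) :
    ∃ C : ℝ, 0 ≤ C ∧ ∀ s : ℂ, T ≤ |s.im| → ‖kernelMellin α β m s‖ ≤ C * ‖s‖ ^ (-3 : ℝ) := by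
  obtain ⟨C, hC0, hC⟩ := exists_norm_kernelMellin_le hα hβ m (M := 1 + (m + α + β) / T)
    (by positivity)
  refine ⟨C, hC0, fun s hs => hC s ?_ fun r h1 h2 => ?_⟩
  · rintro rfl; simp at hs; linarith
  · have := norm_le_mul_norm_add_of_le_abs_im (z := s) (u := -(r : ℂ)) hT (by simpa using hs)
    rw [norm_neg, ← sub_eq_add_neg, Complex.norm_real, Real.norm_eq_abs] at this
    refine this.trans ?_
    gcongr
    rw [abs_le]
    constructor <;> linarith [(m.cast_nonneg : (0 : ℝ) ≤ m)]

theorem exists_norm_kernelMellin_le_of_le {α β : ℝ} (hα : 0 < α) (hβ : 0 < β) (m : ℕ)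
    {c : ℝ} (hc : α + β < c) :
    ∃ C : ℝ, 0 ≤ C ∧ ∀ σ : ℝ, c ≤ σ → ‖kernelMellin α β m σ‖ ≤ C * σ ^ (-3 : ℝ) := by
  have hd : 0 < c - (α + β) := sub_pos.2 hc
  have hc0 : 0 < c := by linarith
  obtain ⟨C, hC0, hC⟩ := exists_norm_kernelMellin_le hα hβ m (M := c / (c - (α + β)))
    (by positivity)
  refine ⟨C, hC0, fun σ hσ => ?_⟩
  have hσ0 : 0 < σ := hc0.trans_le hσ
  have hn : ‖(σ : ℂ)‖ = σ := by rw [Complex.norm_real, Real.norm_eq_abs, abs_of_pos hσ0]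
  have := hC σ (by exact_mod_cast hσ0.ne') fun r h1 h2 => by
    rw [hn, ← Complex.ofReal_sub, Complex.norm_real, Real.norm_eq_abs,
      abs_of_nonneg (by linarith), div_mul_eq_mul_div, le_div_iff₀ hd]
    nlinarith
  rwa [hn] at this

theorem differentiableAt_kernelMellin {α β : ℝ} {m : ℕ} {s : ℂ}
    (h : ∀ r : ℝ, -m ≤ r → r ≤ α + β → s ≠ r) (hα : 0 < α) (hβ : 0 < β) :
    DifferentiableAt ℂ (kernelMellin α β m) s := by
  unfold kernelMellin
  refine DifferentiableAt.fun_sum fun k hk => ?_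
  have hk' : (k : ℝ) ≤ m := by exact_mod_cast Nat.lt_succ_iff.1 (Finset.mem_range.1 hk)
  have hk0 : (0 : ℝ) ≤ k := k.cast_nonneg
  have h1 := sub_ne_zero.2 (h (α + β - k) (by linarith) (by linarith))
  have h2 := sub_ne_zero.2 (h (-k) (by linarith) (by linarith))
  have h3 := sub_ne_zero.2 (h (α - k) (by linarith) (by linarith))
  have h4 := sub_ne_zero.2 (h (β - k) (by linarith) (by linarith))
  push_cast at h1 h2 h3 h4
  fun_prop (disch := assumption)

/-! ### Boundary integrals of rectangles -/

/-- `f` is integrable along the four sides of the rectangle `[x₀, x₁] × [y₀, y₁]`, and its integral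
along the positively oriented boundary is `J`. -/
def HasRectIntegral (f : ℂ → ℂ) (x₀ x₁ y₀ y₁ : ℝ) (J : ℂ) : Prop :=
  (IntervalIntegrable (fun x : ℝ => f (x + y₀ * Complex.I)) MeasureTheory.volume x₀ x₁ ∧
    IntervalIntegrable (fun x : ℝ => f (x + y₁ * Complex.I)) MeasureTheory.volume x₀ x₁ ∧
    IntervalIntegrable (fun y : ℝ => f (x₁ + y * Complex.I)) MeasureTheory.volume y₀ y₁ ∧
    IntervalIntegrable (fun y : ℝ => f (x₀ + y * Complex.I)) MeasureTheory.volume y₀ y₁) ∧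
  (∫ x in x₀..x₁, f (x + y₀ * Complex.I)) - (∫ x in x₀..x₁, f (x + y₁ * Complex.I)) +
    Complex.I * (∫ y in y₀..y₁, f (x₁ + y * Complex.I)) -
    Complex.I * (∫ y in y₀..y₁, f (x₀ + y * Complex.I)) = J

namespace HasRectIntegral

variable {f g : ℂ → ℂ} {x₀ x₁ y₀ y₁ : ℝ} {I J : ℂ}

theorem add (hf : HasRectIntegral f x₀ x₁ y₀ y₁ I) (hg : HasRectIntegral g x₀ x₁ y₀ y₁ J) :
    HasRectIntegral (fun s => f s + g s) x₀ x₁ y₀ y₁ (I + J) := by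
  obtain ⟨⟨f1, f2, f3, f4⟩, hf⟩ := hf
  obtain ⟨⟨g1, g2, g3, g4⟩, hg⟩ := hg
  refine ⟨⟨f1.add g1, f2.add g2, f3.add g3, f4.add g4⟩, ?_⟩
  rw [intervalIntegral.integral_add f1 g1, intervalIntegral.integral_add f2 g2,
    intervalIntegral.integral_add f3 g3, intervalIntegral.integral_add f4 g4, ← hf, ← hg]
  ring

theorem const_mul (hf : HasRectIntegral f x₀ x₁ y₀ y₁ I) (a : ℂ) :
    HasRectIntegral (fun s => a * f s) x₀ x₁ y₀ y₁ (a * I) := by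
  obtain ⟨⟨f1, f2, f3, f4⟩, hf⟩ := hf
  refine ⟨⟨f1.const_mul a, f2.const_mul a, f3.const_mul a, f4.const_mul a⟩, ?_⟩
  simp only [intervalIntegral.integral_const_mul]
  rw [← hf]
  ring

theorem sub (hf : HasRectIntegral f x₀ x₁ y₀ y₁ I) (hg : HasRectIntegral g x₀ x₁ y₀ y₁ J) :
    HasRectIntegral (fun s => f s - g s) x₀ x₁ y₀ y₁ (I - J) := by
  have := hf.add (hg.const_mul (-1))
  simpa only [neg_one_mul, ← sub_eq_add_neg] using this

theorem sum {ι : Type*} (t : Finset ι) {f : ι → ℂ → ℂ} {I : ι → ℂ}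
    (h : ∀ i ∈ t, HasRectIntegral (f i) x₀ x₁ y₀ y₁ (I i)) :
    HasRectIntegral (fun s => ∑ i ∈ t, f i s) x₀ x₁ y₀ y₁ (∑ i ∈ t, I i) := by
  classical
  induction t using Finset.induction_on with
  | empty => simp [HasRectIntegral]
  | insert i t hi ih =>
    simp only [Finset.sum_insert hi]
    exact (h i (Finset.mem_insert_self i t)).add
      (ih fun k hk => h k (Finset.mem_insert_of_mem hk))

theorem congr (hf : HasRectIntegral f x₀ x₁ y₀ y₁ I)
    (hx : ∀ x : ℝ, f (x + y₀ * Complex.I) = g (x + y₀ * Complex.I) ∧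
      f (x + y₁ * Complex.I) = g (x + y₁ * Complex.I))
    (hy : ∀ y : ℝ, f (x₁ + y * Complex.I) = g (x₁ + y * Complex.I) ∧
      f (x₀ + y * Complex.I) = g (x₀ + y * Complex.I)) :
    HasRectIntegral g x₀ x₁ y₀ y₁ I := by
  unfold HasRectIntegral at hf ⊢
  simpa only [(hx _).1, (hx _).2, (hy _).1, (hy _).2] using hf

theorem of_differentiableOn
    (h : DifferentiableOn ℂ f (Set.uIcc x₀ x₁ ×ℂ Set.uIcc y₀ y₁)) :
    HasRectIntegral f x₀ x₁ y₀ y₁ 0 := by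
  have hx : ∀ y ∈ Set.uIcc y₀ y₁,
      IntervalIntegrable (fun x : ℝ => f (x + y * Complex.I)) MeasureTheory.volume x₀ x₁ := by
    intro y hy
    refine ContinuousOn.intervalIntegrable (h.continuousOn.comp (by fun_prop) fun x hx => ?_)
    rw [Complex.mem_reProdIm]; simpa using ⟨hx, hy⟩
  have hy : ∀ x ∈ Set.uIcc x₀ x₁,
      IntervalIntegrable (fun y : ℝ => f (x + y * Complex.I)) MeasureTheory.volume y₀ y₁ := by
    intro x hx
    refine ContinuousOn.intervalIntegrable (h.continuousOn.comp (by fun_prop) fun y hy => ?_)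
    rw [Complex.mem_reProdIm]; simpa using ⟨hx, hy⟩
  refine ⟨⟨hx _ Set.left_mem_uIcc, hx _ Set.right_mem_uIcc, hy _ Set.right_mem_uIcc,
    hy _ Set.left_mem_uIcc⟩, ?_⟩
  have := Complex.integral_boundary_rect_eq_zero_of_differentiableOn f (x₀ + y₀ * Complex.I)
    (x₁ + y₁ * Complex.I) (by simpa using h)
  simpa using this

/-- The principal logarithm is a primitive on the horizontal sides and on the right side. The left
side crosses the cut and is first reflected to the right of it; each of its two corners then
contributes `πi`. -/
theorem one_div_sub {r R : ℝ} (h₀ : x₀ < r) (h₁ : r < x₁) (hR : 0 < R) :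
    HasRectIntegral (fun s => 1 / (s - r)) x₀ x₁ (-R) R (2 * Real.pi * Complex.I) := by
  have slit : ∀ x y : ℝ, y ≠ 0 → (x : ℂ) + y * Complex.I ∈ Complex.slitPlane := fun x y hy => by
    right; simpa using hy
  have slit' : ∀ x y : ℝ, 0 < x → (x : ℂ) + y * Complex.I ∈ Complex.slitPlane := fun x y hx => by
    left; simpa using hx
  have hI : ∀ y : ℝ, HasDerivAt (fun y : ℝ => (y : ℂ) * Complex.I) Complex.I y := fun y => by
    simpa using (Complex.ofRealCLM.hasDerivAt (x := y)).mul_const Complex.I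
  have hor : ∀ y : ℝ, y ≠ 0 →
      IntervalIntegrable (fun x : ℝ => 1 / ((x : ℂ) + y * Complex.I - r)) MeasureTheory.volume
        x₀ x₁ ∧
      ∫ x in x₀..x₁, 1 / ((x : ℂ) + y * Complex.I - r) =
        Complex.log ((x₁ - r : ℝ) + y * Complex.I) -
          Complex.log ((x₀ - r : ℝ) + y * Complex.I) := by
    intro y hy
    have e : ∀ x : ℝ, (x : ℂ) + y * Complex.I - r = (x - r : ℝ) + y * Complex.I := fun x => by
      push_cast; ring
    simp only [e]
    have hint : IntervalIntegrable (fun x : ℝ => 1 / (((x - r : ℝ) : ℂ) + y * Complex.I))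
        MeasureTheory.volume x₀ x₁ := by
      refine Continuous.intervalIntegrable (continuous_const.div (by fun_prop) fun x => ?_) _ _
      exact Complex.slitPlane_ne_zero (slit _ _ hy)
    refine ⟨hint, intervalIntegral.integral_eq_sub_of_hasDerivAt
      (f := fun x : ℝ => Complex.log ((x - r : ℝ) + y * Complex.I)) (fun x _ => ?_) hint⟩
    have h1 : HasDerivAt (fun x : ℝ => ((x - r : ℝ) : ℂ) + y * Complex.I) 1 x := by
      have := ((hasDerivAt_id x).sub_const r).ofReal_comp
      simpa using this.add_const (y * Complex.I)
    exact h1.clog_real (slit _ _ hy)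
  have ver : ∀ x : ℝ, x ≠ 0 →
      IntervalIntegrable (fun y : ℝ => 1 / ((x : ℂ) + y * Complex.I)) MeasureTheory.volume
        (-R) R := by
    intro x hx
    refine Continuous.intervalIntegrable (continuous_const.div (by fun_prop) fun y h => ?_) _ _
    have := congrArg Complex.re h
    simp at this
    exact hx this
  have verI : ∀ x : ℝ, 0 < x → Complex.I * ∫ y in (-R)..R, 1 / ((x : ℂ) + y * Complex.I) =
      Complex.log (x + R * Complex.I) - Complex.log (x + (-R : ℝ) * Complex.I) := by
    intro x hx
    rw [← intervalIntegral.integral_const_mul]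
    refine intervalIntegral.integral_eq_sub_of_hasDerivAt
      (f := fun y : ℝ => Complex.log (x + y * Complex.I)) (fun y _ => ?_)
      ((ver x hx.ne').const_mul _)
    rw [mul_one_div]
    exact ((hI y).const_add (x : ℂ)).clog_real (slit' _ _ hx)
  have e : ∀ x y : ℝ, (x : ℂ) + y * Complex.I - r = (x - r : ℝ) + y * Complex.I := fun x y => by
    push_cast; ring
  refine ⟨⟨(hor _ (neg_ne_zero.2 hR.ne')).1, (hor _ hR.ne').1, ?_, ?_⟩, ?_⟩
  · simpa only [e] using ver _ (sub_pos.2 h₁).ne'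
  · simpa only [e] using ver _ (sub_neg.2 h₀).ne
  · rw [(hor _ (neg_ne_zero.2 hR.ne')).2, (hor _ hR.ne').2]
    simp only [e]
    rw [verI _ (sub_pos.2 h₁)]
    have hleft : ∫ y in (-R)..R, 1 / (((x₀ - r : ℝ) : ℂ) + y * Complex.I) =
        -∫ y in (-R)..R, 1 / (((r - x₀ : ℝ) : ℂ) + y * Complex.I) := by
      rw [← intervalIntegral.integral_neg]
      have := intervalIntegral.integral_comp_neg (a := -R) (b := R)
        (fun y : ℝ => -(1 / (((r - x₀ : ℝ) : ℂ) + y * Complex.I)))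
      rw [neg_neg] at this
      rw [← this]
      refine intervalIntegral.integral_congr fun y _ => ?_
      rw [← div_neg]
      congr 1
      push_cast; ring
    rw [hleft, mul_neg, verI _ (sub_pos.2 h₀)]
    have l1 : Complex.log ((x₀ - r : ℝ) + R * Complex.I) -
        Complex.log ((r - x₀ : ℝ) + (-R : ℝ) * Complex.I) = Real.pi * Complex.I := by
      have e1 : ((r - x₀ : ℝ) : ℂ) + (-R : ℝ) * Complex.I =
          -((x₀ - r : ℝ) + R * Complex.I) := by push_cast; ring
      rw [e1, Complex.log, Complex.log, norm_neg,
        Complex.arg_neg_eq_arg_sub_pi_of_im_pos (by simpa using hR)]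
      push_cast; ring
    have l2 : Complex.log ((r - x₀ : ℝ) + R * Complex.I) -
        Complex.log ((x₀ - r : ℝ) + (-R : ℝ) * Complex.I) = Real.pi * Complex.I := by
      have e1 : ((x₀ - r : ℝ) : ℂ) + (-R : ℝ) * Complex.I =
          -((r - x₀ : ℝ) + R * Complex.I) := by push_cast; ring
      rw [e1, Complex.log, Complex.log, norm_neg,
        Complex.arg_neg_eq_arg_sub_pi_of_im_pos (by simpa using hR)]
      push_cast; ring
    linear_combination l1 + l2

/-- Cauchy's integral formula for a rectangle. -/
theorem mul_one_div_sub {r R : ℝ} (h₀ : x₀ < r) (h₁ : r < x₁) (hR : 0 < R)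
    (hf : DifferentiableOn ℂ f (Set.uIcc x₀ x₁ ×ℂ Set.uIcc (-R) R)) :
    HasRectIntegral (fun s => f s * (1 / (s - r))) x₀ x₁ (-R) R
      (f r * (2 * Real.pi * Complex.I)) := by
  have hnhds : (Set.uIcc x₀ x₁ ×ℂ Set.uIcc (-R) R) ∈ 𝓝 (r : ℂ) := by
    rw [Set.uIcc_of_le (h₀.trans h₁).le, Set.uIcc_of_le (by linarith)]
    refine Filter.mem_of_superset ((isOpen_Ioo.reProdIm isOpen_Ioo).mem_nhds
      (s := Set.Ioo x₀ x₁ ×ℂ Set.Ioo (-R) R) ?_)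
      (Set.inter_subset_inter (Set.preimage_mono Set.Ioo_subset_Icc_self)
        (Set.preimage_mono Set.Ioo_subset_Icc_self))
    rw [Complex.mem_reProdIm]
    simpa using ⟨⟨h₀, h₁⟩, hR⟩
  -- `f s / (s - r)` is `dslope f r s`, which is holomorphic, plus `f r / (s - r)`.
  have hd := of_differentiableOn ((Complex.differentiableOn_dslope hnhds).2 hf)
  have key := hd.add ((one_div_sub h₀ h₁ hR).const_mul (f r))
  rw [zero_add] at key
  have e : ∀ s : ℂ, s ≠ r → dslope f r s + f r * (1 / (s - r)) = f s * (1 / (s - r)) := by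
    intro s hs
    have : s - r ≠ 0 := sub_ne_zero.2 hs
    rw [dslope_of_ne _ hs, slope_def_field]
    field_simp
    ring
  have hv : ∀ x y : ℝ, x ≠ r ∨ y ≠ 0 → (x : ℂ) + y * Complex.I ≠ r := by
    intro x y h heq
    have h1 := congrArg Complex.re heq
    have h2 := congrArg Complex.im heq
    simp at h1 h2
    rcases h with h | h
    · exact h h1
    · exact h h2
  exact key.congr
    (fun x => ⟨e _ (hv _ _ (Or.inr (neg_ne_zero.2 hR.ne'))), e _ (hv _ _ (Or.inr hR.ne'))⟩)
    (fun y => ⟨e _ (hv _ _ (Or.inl h₁.ne')), e _ (hv _ _ (Or.inl h₀.ne))⟩)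

/-- The reflection in the centre of the rectangle exchanges opposite sides, and oddness makes their
contributions to the oriented boundary integral equal. -/
theorem eq_of_reflect {R : ℝ} (h : HasRectIntegral f x₀ x₁ (-R) R J)
    (hodd : ∀ s, f ((x₀ + x₁ : ℝ) - s) = -f s) :
    J = 2 * (Complex.I * ∫ y in (-R)..R, f (x₁ + y * Complex.I)) -
      2 * ∫ x in x₀..x₁, f (x + R * Complex.I) := by
  have h1 : ∫ x in x₀..x₁, f (x + (-R : ℝ) * Complex.I) =
      -∫ x in x₀..x₁, f (x + R * Complex.I) := by
    rw [← intervalIntegral.integral_neg]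
    have := intervalIntegral.integral_comp_sub_left (a := x₀) (b := x₁)
      (fun x : ℝ => f (x + (-R : ℝ) * Complex.I)) (x₀ + x₁)
    rw [add_sub_cancel_right, add_sub_cancel_left] at this
    rw [← this]
    refine intervalIntegral.integral_congr fun x _ => ?_
    rw [← hodd]
    congr 1
    push_cast; ring
  have h2 : ∫ y in (-R)..R, f (x₀ + y * Complex.I) =
      -∫ y in (-R)..R, f (x₁ + y * Complex.I) := by
    rw [← intervalIntegral.integral_neg]
    have := intervalIntegral.integral_comp_neg (a := -R) (b := R)
      (fun y : ℝ => f (x₀ + y * Complex.I))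
    rw [neg_neg] at this
    rw [← this]
    refine intervalIntegral.integral_congr fun x _ => ?_
    rw [← hodd]
    congr 1
    push_cast; ring
  rw [← h.2, h1, h2]
  ring

end HasRectIntegral

/-! ### Rotation of the rays of the loop -/

/-- Rotation of a horizontal ray into a vertical one, for a function that is
`O(|s| ^ (-q))`, `q > 1`, on the quadrant between them. -/
theorem tendsto_integral_vertical_of_norm_le_rpow {f : ℂ → ℂ} {c T C q e : ℝ} (hc : 0 < c)
    (hT : 0 < T) (hq : 1 < q) (he : e = 1 ∨ e = -1) (hC : 0 ≤ C)
    (hd : ∀ s : ℂ, c ≤ s.re → T ≤ e * s.im → DifferentiableAt ℂ f s)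
    (hb : ∀ s : ℂ, c ≤ s.re → T ≤ e * s.im → ‖f s‖ ≤ C * ‖s‖ ^ (-q)) :
    Tendsto (fun R : ℝ => Complex.I * ∫ t in (e * T)..(e * R), f (c + t * Complex.I)) atTop
      (𝓝 (∫ σ in Set.Ioi c, f (σ + (e * T : ℝ) * Complex.I))) := by
  have hee : e * e = 1 := by rcases he with rfl | rfl <;> norm_num
  have heabs : |e| = 1 := by rcases he with rfl | rfl <;> norm_num
  have hint : MeasureTheory.IntegrableOn (fun σ : ℝ => f (σ + (e * T : ℝ) * Complex.I))
      (Set.Ioi c) := by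
    refine MeasureTheory.Integrable.mono'
      (((integrableOn_Ioi_rpow_of_lt (by linarith : -q < -1) hc)).const_mul C) ?_ ?_
    · refine ContinuousOn.aestronglyMeasurable (fun σ hσ => ?_) measurableSet_Ioi
      have h1 : ContinuousAt f (σ + (e * T : ℝ) * Complex.I) :=
        (hd _ (by simpa using (Set.mem_Ioi.1 hσ).le) (by
          have : e * (e * T) = T := by rw [← mul_assoc, hee, one_mul]
          simp [this])).continuousAt
      exact (ContinuousAt.comp (f := fun σ : ℝ => (σ : ℂ) + (e * T : ℝ) * Complex.I) h1
        (by fun_prop)).continuousWithinAt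
    · refine (MeasureTheory.ae_restrict_iff' measurableSet_Ioi).2 (.of_forall fun σ hσ => ?_)
      have hσ' : c < σ := hσ
      refine (hb _ (by simpa using hσ'.le) (by
        have : e * (e * T) = T := by rw [← mul_assoc, hee, one_mul]
        simp [this])).trans ?_
      gcongr 1
      refine Real.rpow_le_rpow_of_nonpos (hc.trans hσ') ?_ (by linarith)
      refine le_trans ?_ (Complex.abs_re_le_norm _)
      simpa using le_abs_self σ
  have h1 := MeasureTheory.intervalIntegral_tendsto_integral_Ioi c hint tendsto_id
  -- In the rectangle with corners `c + ieT` and `R + ieR`, the two far sides have length at most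
  -- `R` and `f = O(R ^ (-q))` on them. The sign `e` selects the upper or the lower quadrant.
  have h0 : Tendsto (fun R : ℝ => C * R ^ (1 - q)) atTop (𝓝 0) := by
    have := (tendsto_rpow_neg_atTop (by linarith : 0 < q - 1)).const_mul C
    simpa using this
  have small : ∀ R : ℝ, 0 < R → C * R ^ (-q) * R = C * R ^ (1 - q) := fun R hR => by
    rw [sub_eq_neg_add, Real.rpow_add hR, Real.rpow_one, mul_assoc]
  have h2 : Tendsto (fun R : ℝ => ∫ σ in c..R, f (σ + (e * R : ℝ) * Complex.I)) atTop (𝓝 0) := by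
    refine squeeze_zero_norm' ?_ h0
    filter_upwards [eventually_ge_atTop (max c T)] with R hR
    have hcR := (le_max_left c T).trans hR
    have hTR := (le_max_right c T).trans hR
    have hR0 : 0 < R := hc.trans_le hcR
    refine (intervalIntegral.norm_integral_le_of_norm_le_const (C := C * R ^ (-q))
      fun σ hσ => ?_).trans ?_
    · rw [Set.uIoc_of_le hcR] at hσ
      refine (hb _ (by simpa using hσ.1.le) (by
        have : e * (e * R) = R := by rw [← mul_assoc, hee, one_mul]
        simpa [this] using hTR)).trans ?_
      gcongr 1
      refine Real.rpow_le_rpow_of_nonpos hR0 ?_ (by linarith)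
      refine le_trans ?_ (Complex.abs_im_le_norm _)
      simp [abs_mul, heabs, abs_of_pos hR0]
    · rw [← small R hR0, abs_of_nonneg (by linarith)]
      gcongr
      linarith
  have h3 : Tendsto (fun R : ℝ => Complex.I * ∫ t in (e * T)..(e * R), f (R + t * Complex.I))
      atTop (𝓝 0) := by
    refine squeeze_zero_norm' ?_ h0
    filter_upwards [eventually_ge_atTop (max c T)] with R hR
    have hcR := (le_max_left c T).trans hR
    have hTR := (le_max_right c T).trans hR
    have hR0 : 0 < R := hc.trans_le hcR
    rw [norm_mul, Complex.norm_I, one_mul]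
    refine (intervalIntegral.norm_integral_le_of_norm_le_const (C := C * R ^ (-q))
      fun t ht => ?_).trans ?_
    · have ht' : T ≤ e * t := by
        rcases he with rfl | rfl
        · rw [one_mul, one_mul, Set.uIoc_of_le hTR] at ht
          linarith [ht.1]
        · rw [Set.uIoc_of_ge (by linarith)] at ht
          linarith [ht.2]
      refine (hb _ (by simpa using hcR) (by simpa using ht')).trans ?_
      gcongr 1
      refine Real.rpow_le_rpow_of_nonpos hR0 ?_ (by linarith)
      refine le_trans ?_ (Complex.abs_re_le_norm _)
      simpa using le_abs_self R
    · rw [← small R hR0, ← mul_sub, abs_mul, heabs, one_mul, abs_of_nonneg (by linarith)]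
      gcongr
      linarith
  have h4 := (h1.sub h2).add h3
  rw [sub_zero, add_zero] at h4
  refine h4.congr' ?_
  filter_upwards [eventually_ge_atTop (max c T)] with R hR
  have hcR := (le_max_left c T).trans hR
  have hTR := (le_max_right c T).trans hR
  have hrect := (HasRectIntegral.of_differentiableOn (f := f) (x₀ := c) (x₁ := R) (y₀ := e * T)
    (y₁ := e * R) fun s hs => by
      rw [Complex.mem_reProdIm, Set.uIcc_of_le hcR] at hs
      refine (hd s hs.1.1 ?_).differentiableWithinAt
      rcases he with rfl | rfl
      · have := hs.2
        rw [one_mul, one_mul, Set.uIcc_of_le hTR] at this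
        linarith [this.1]
      · have := hs.2
        rw [Set.uIcc_of_ge (by linarith)] at this
        linarith [this.2]).2
  simp only [id]
  linear_combination hrect

/-! ### Evaluation of the loop integral by residues -/

/-- The finite sum of differences of quotients of products of Gamma functions. -/
noncomputable def gammaDifferenceSum {p : ℕ} (a b : Fin p → ℂ) (α β : ℝ) (m : ℕ) : ℂ :=
  ∑ k ∈ Finset.range (m + 1),
    (gammaProd a k * gammaProd a (α + β + m - k) / (gammaProd b k * gammaProd b (α + β + m - k)) -
      gammaProd a (α + k) * gammaProd a (β + m - k) /
        (gammaProd b (α + k) * gammaProd b (β + m - k)))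

/-- The reflection sends `-k` to `α + β - (m - k)` and `β - k` to `α - (m - k)`. Reversing the order
of summation shows that the four families of values agree in pairs. -/
theorem sum_gammaQuotient_poles {p : ℕ} (a b : Fin p → ℂ) (α β : ℝ) (m : ℕ) :
    ∑ k ∈ Finset.range (m + 1),
      (gammaQuotient a b (α + β) m (α + β - k : ℝ) + gammaQuotient a b (α + β) m (-k : ℝ) -
        gammaQuotient a b (α + β) m (α - k : ℝ) - gammaQuotient a b (α + β) m (β - k : ℝ)) =
      2 * gammaDifferenceSum a b α β m := by
  have r1 := Finset.sum_range_reflect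
    (fun k : ℕ => gammaQuotient a b (α + β) m (α + β - k : ℝ)) (m + 1)
  have r2 := Finset.sum_range_reflect
    (fun k : ℕ => gammaQuotient a b (α + β) m (α - k : ℝ)) (m + 1)
  have q1 : ∑ k ∈ Finset.range (m + 1), gammaQuotient a b (α + β) m (-k : ℝ) =
      ∑ k ∈ Finset.range (m + 1), gammaQuotient a b (α + β) m (α + β - k : ℝ) := by
    rw [← r1]
    refine Finset.sum_congr rfl fun k hk => ?_
    rw [← gammaQuotient_reflect]
    congr 1
    rw [Nat.add_sub_cancel, Nat.cast_sub (Nat.lt_succ_iff.1 (Finset.mem_range.1 hk))]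
    push_cast; ring
  have q2 : ∑ k ∈ Finset.range (m + 1), gammaQuotient a b (α + β) m (β - k : ℝ) =
      ∑ k ∈ Finset.range (m + 1), gammaQuotient a b (α + β) m (α - k : ℝ) := by
    rw [← r2]
    refine Finset.sum_congr rfl fun k hk => ?_
    rw [← gammaQuotient_reflect]
    congr 1
    rw [Nat.add_sub_cancel, Nat.cast_sub (Nat.lt_succ_iff.1 (Finset.mem_range.1 hk))]
    push_cast; ring
  have q3 : ∑ k ∈ Finset.range (m + 1), gammaQuotient a b (α + β) m (α + β - k : ℝ) -
      ∑ k ∈ Finset.range (m + 1), gammaQuotient a b (α + β) m (β - k : ℝ) =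
      gammaDifferenceSum a b α β m := by
    rw [gammaDifferenceSum, ← Finset.sum_sub_distrib]
    refine Finset.sum_congr rfl fun k _ => ?_
    have e1 : (((α + β : ℝ) : ℂ) - (α + β - k : ℝ)) = k := by push_cast; ring
    have e2 : (((m : ℝ) : ℂ) + (α + β - k : ℝ)) = α + β + m - k := by push_cast; ring
    have e3 : (((α + β : ℝ) : ℂ) - (β - k : ℝ)) = α + k := by push_cast; ring
    have e4 : (((m : ℝ) : ℂ) + (β - k : ℝ)) = β + m - k := by push_cast; ring
    rw [gammaQuotient, gammaQuotient, e1, e2, e3, e4, mul_comm (gammaProd b k),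
      mul_comm (gammaProd b (α + k))]
  simp only [Finset.sum_sub_distrib, Finset.sum_add_distrib]
  rw [← q3, q1, q2]
  ring

/-- The product of the Gamma quotient and the Mellin transform of the kernel. -/
noncomputable def gammaQuotientMulKernel {p : ℕ} (a b : Fin p → ℂ) (α β : ℝ) (m : ℕ) (s : ℂ) : ℂ :=
  gammaQuotient a b (α + β) m s * kernelMellin α β m s

/-- As `d < Re (a j)`, the Gamma quotient is holomorphic on the rectangle. Cauchy's formula is
applied to each partial fraction separately, so coinciding poles need no special treatment. -/
theorem hasRectIntegral_gammaQuotientMulKernel {p : ℕ} {a b : Fin p → ℂ} {α β : ℝ} {m : ℕ}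
    (hα : 0 < α) (hβ : 0 < β) {d : ℝ} (hd : 0 < d) (had : ∀ j, d < (a j).re) {R : ℝ}
    (hR : 0 < R) :
    HasRectIntegral (gammaQuotientMulKernel a b α β m) (-(m + d)) (α + β + d) (-R) R
      (2 * gammaDifferenceSum a b α β m * (2 * Real.pi * Complex.I)) := by
  have hm : (0 : ℝ) ≤ m := m.cast_nonneg
  have hF : DifferentiableOn ℂ (gammaQuotient a b (α + β) m)
      (Set.uIcc (-(m + d)) (α + β + d) ×ℂ Set.uIcc (-R) R) := by
    intro s hs
    rw [Complex.mem_reProdIm, Set.uIcc_of_le (by linarith)] at hs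
    refine (differentiableAt_gammaQuotient fun j => Or.inr ⟨?_, ?_⟩).differentiableWithinAt
    · linarith [hs.1.2, had j]
    · linarith [hs.1.1, had j]
  have hpole : ∀ r : ℝ, -m ≤ r → r ≤ α + β →
      HasRectIntegral (fun s => gammaQuotient a b (α + β) m s * (1 / (s - r))) (-(m + d))
        (α + β + d) (-R) R (gammaQuotient a b (α + β) m r * (2 * Real.pi * Complex.I)) :=
    fun r h1 h2 => HasRectIntegral.mul_one_div_sub (by linarith) (by linarith) hR hF
  have key := HasRectIntegral.sum (Finset.range (m + 1)) fun k hk => by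
    have hk' : (k : ℝ) ≤ m := by exact_mod_cast Nat.lt_succ_iff.1 (Finset.mem_range.1 hk)
    have hk0 : (0 : ℝ) ≤ k := k.cast_nonneg
    exact (((hpole (α + β - k) (by linarith) (by linarith)).add
      (hpole (-k) (by linarith) (by linarith))).sub
      (hpole (α - k) (by linarith) (by linarith))).sub
      (hpole (β - k) (by linarith) (by linarith))
  simp only [← sub_mul, ← add_mul, ← Finset.sum_mul] at key
  rw [sum_gammaQuotient_poles] at key
  convert key using 2 with s
  rw [gammaQuotientMulKernel, kernelMellin, Finset.mul_sum]
  refine Finset.sum_congr rfl fun k _ => ?_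
  push_cast
  ring

theorem exists_norm_gammaQuotientMulKernel_le {p : ℕ} {a b : Fin p → ℂ} {α β : ℝ} (m : ℕ)
    (hα : 0 < α) (hβ : 0 < β) {T : ℝ} (hT : 0 < T) (haT : ∀ j, |(a j).im| < T) :
    ∃ C : ℝ, 0 ≤ C ∧ ∀ s : ℂ, T ≤ |s.im| → ‖gammaQuotientMulKernel a b α β m s‖ ≤
      C * ‖s‖ ^ (-(3 - 2 * ((∑ j, a j).re - (∑ j, b j).re))) := by
  obtain ⟨C₁, h₁, H₁⟩ := exists_norm_gammaQuotient_le a b (α + β) m hT haT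
  obtain ⟨C₂, h₂, H₂⟩ := exists_norm_kernelMellin_le_of_le_abs_im hα hβ m hT
  refine ⟨C₁ * C₂, by positivity, fun s hs => ?_⟩
  have hs0 : 0 < ‖s‖ := hT.trans_le (hs.trans (Complex.abs_im_le_norm s))
  rw [gammaQuotientMulKernel, norm_mul]
  refine (mul_le_mul (H₁ s hs) (H₂ s hs) (norm_nonneg _) (by positivity)).trans (le_of_eq ?_)
  rw [neg_sub, sub_eq_add_neg _ (3 : ℝ), Real.rpow_add hs0]
  ring

theorem gammaQuotientMulKernel_reflect {p : ℕ} (a b : Fin p → ℂ) (α β : ℝ) (m : ℕ) (s : ℂ) :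
    gammaQuotientMulKernel a b α β m ((α + β : ℝ) - m - s) =
      -gammaQuotientMulKernel a b α β m s := by
  have := gammaQuotient_reflect a b (α + β) m s
  rw [Complex.ofReal_natCast] at this
  rw [gammaQuotientMulKernel, gammaQuotientMulKernel, kernelMellin_reflect, this, mul_neg]

/-- Rotating both rays turns the loop into the line `Re s = c`. That line and its mirror image `Re s
= -(m + d)` bound a strip whose residues are known, and oddness makes the line integral half the
boundary integral. -/
theorem loopIntegral_gammaQuotientMulKernel {p : ℕ} {a b : Fin p → ℂ} {α β : ℝ} (m : ℕ)
    (hα : 0 < α) (hβ : 0 < β) (hab : (∑ j, a j).re < (∑ j, b j).re + 1) {d T : ℝ} (hd : 0 < d)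
    (had : ∀ j, d < (a j).re) (hT : 0 < T) (haT : ∀ j, |(a j).im| < T) :
    loopIntegral (gammaQuotientMulKernel a b α β m) (α + β + d) T =
      2 * Real.pi * Complex.I * gammaDifferenceSum a b α β m := by
  set f := gammaQuotientMulKernel a b α β m
  set c := α + β + d
  have hc : 0 < c := by positivity
  have hm : (0 : ℝ) ≤ m := m.cast_nonneg
  set q := 3 - 2 * ((∑ j, a j).re - (∑ j, b j).re) with hqdef
  have hq : 1 < q := by rw [hqdef]; linarith
  obtain ⟨C, hC, hb⟩ := exists_norm_gammaQuotientMulKernel_le (b := b) m hα hβ hT haT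
  have hdiff : ∀ s : ℂ, T ≤ |s.im| → DifferentiableAt ℂ f s := fun s hs => by
    refine DifferentiableAt.mul (differentiableAt_gammaQuotient fun j => Or.inl ?_)
      (differentiableAt_kernelMellin (fun r _ _ h => ?_) hα hβ)
    · exact (haT j).trans_le hs
    · rw [h] at hs; simp at hs; linarith
  have hint : ∀ x y : ℝ, IntervalIntegrable (fun t : ℝ => f (c + t * Complex.I))
      MeasureTheory.volume x y := fun x y => by
    refine Continuous.intervalIntegrable (continuous_iff_continuousAt.2 fun t => ?_) _ _
    have h1 : DifferentiableAt ℂ f (c + t * Complex.I) := by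
      refine DifferentiableAt.mul (differentiableAt_gammaQuotient fun j => Or.inr ?_)
        (differentiableAt_kernelMellin (fun r _ h2 h => ?_) hα hβ)
      · have := had j
        simp only [Complex.add_re, Complex.ofReal_re, Complex.mul_re, Complex.I_re, mul_zero,
          Complex.ofReal_im, Complex.I_im, mul_one, sub_self, add_zero]
        constructor <;> simp only [c] <;> linarith
      · have := congrArg Complex.re h
        simp at this
        linarith
    exact ContinuousAt.comp (f := fun t : ℝ => (c : ℂ) + t * Complex.I) h1.continuousAt
      (by fun_prop)
  have e₁ : ∀ s : ℂ, T ≤ 1 * s.im → T ≤ |s.im| := fun s hs => by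
    rw [one_mul] at hs; exact hs.trans (le_abs_self _)
  have e₂ : ∀ s : ℂ, T ≤ -1 * s.im → T ≤ |s.im| := fun s hs => by
    rw [neg_one_mul] at hs; exact hs.trans (neg_le_abs _)
  have t₁ := tendsto_integral_vertical_of_norm_le_rpow (f := f) hc hT hq (Or.inl rfl) hC
    (fun s _ hs => hdiff s (e₁ s hs)) (fun s _ hs => hb s (e₁ s hs))
  have t₂ := tendsto_integral_vertical_of_norm_le_rpow (f := f) hc hT hq (Or.inr rfl) hC
    (fun s _ hs => hdiff s (e₂ s hs)) (fun s _ hs => hb s (e₂ s hs))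
  simp only [one_mul, neg_one_mul] at t₁ t₂
  have hV : Tendsto (fun R : ℝ => Complex.I * ∫ t in (-R)..R, f (c + t * Complex.I)) atTop
      (𝓝 (loopIntegral f c T)) := by
    have := (t₂.neg.add (tendsto_const_nhds
      (x := Complex.I * ∫ t in (-T)..T, f (c + t * Complex.I)))).add t₁
    have hL : loopIntegral f c T = -(∫ σ in Set.Ioi c, f (σ + (-T : ℝ) * Complex.I)) +
        Complex.I * (∫ t in (-T)..T, f (c + t * Complex.I)) +
        ∫ σ in Set.Ioi c, f (σ + T * Complex.I) := by
      rw [loopIntegral]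
      simp only [Complex.ofReal_neg, neg_mul, ← sub_eq_add_neg]
    rw [hL]
    refine this.congr fun R => ?_
    rw [← mul_neg, ← intervalIntegral.integral_symm, ← mul_add, ← mul_add,
      intervalIntegral.integral_add_adjacent_intervals (hint _ _) (hint _ _),
      intervalIntegral.integral_add_adjacent_intervals (hint _ _) (hint _ _)]
  -- The horizontal side has fixed length, so any decay of the integrand suffices.
  have htop : Tendsto (fun R : ℝ => ∫ x in (-(m + d))..c, f (x + R * Complex.I)) atTop
      (𝓝 0) := by
    have h0 : Tendsto (fun R : ℝ => C * R ^ (-q) * |c - -(m + d)|) atTop (𝓝 0) := by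
      have := ((tendsto_rpow_neg_atTop (by linarith : 0 < q)).const_mul C).mul_const
        |c - -(m + d)|
      simpa using this
    refine squeeze_zero_norm' ?_ h0
    filter_upwards [eventually_ge_atTop T] with R hR
    have hR0 := hT.trans_le hR
    refine intervalIntegral.norm_integral_le_of_norm_le_const fun x _ => ?_
    have him : R = |((x : ℂ) + R * Complex.I).im| := by simp [abs_of_pos hR0]
    refine (hb _ (hR.trans him.le)).trans ?_
    gcongr 1
    refine Real.rpow_le_rpow_of_nonpos hR0 ?_ (by linarith)
    exact him.le.trans (Complex.abs_im_le_norm _)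
  have hlim := (hV.const_mul 2).sub (htop.const_mul 2)
  have hconst : Tendsto (fun R : ℝ => 2 * (Complex.I * ∫ t in (-R)..R, f (c + t * Complex.I)) -
      2 * ∫ x in (-(m + d))..c, f (x + R * Complex.I)) atTop
      (𝓝 (2 * gammaDifferenceSum a b α β m * (2 * Real.pi * Complex.I))) := by
    refine tendsto_const_nhds.congr' ?_
    filter_upwards [eventually_gt_atTop 0] with R hR
    refine (hasRectIntegral_gammaQuotientMulKernel hα hβ hd had hR).eq_of_reflect fun s => ?_
    rw [← gammaQuotientMulKernel_reflect]
    congr 1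
    push_cast; ring
  have := tendsto_nhds_unique hlim hconst
  linear_combination this / 2

/-! ### The kernel and the interchange of integrals -/

/-- The kernel against which Meijer's `G` function is integrated. -/
noncomputable def gammaSumKernel (α β : ℝ) (m : ℕ) (x : ℝ) : ℝ :=
  (1 - x ^ (m + 1)) * (1 - x ^ α) * (1 - x ^ β) / (x ^ (α + β + 1) * (1 - x))

theorem gammaSumKernel_pos {α β : ℝ} (hα : 0 < α) (hβ : 0 < β) (m : ℕ) {x : ℝ}
    (hx : x ∈ Set.Ioo (0 : ℝ) 1) : 0 < gammaSumKernel α β m x := by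
  have h1 : 0 < 1 - x ^ (m + 1) := sub_pos.2 (pow_lt_one₀ hx.1.le hx.2 (by simp))
  have h2 : 0 < 1 - x ^ α := sub_pos.2 (Real.rpow_lt_one hx.1.le hx.2 hα)
  have h3 : 0 < 1 - x ^ β := sub_pos.2 (Real.rpow_lt_one hx.1.le hx.2 hβ)
  have h4 : 0 < 1 - x := sub_pos.2 hx.2
  have h5 : 0 < x ^ (α + β + 1) := Real.rpow_pos_of_pos hx.1 _
  unfold gammaSumKernel
  positivity

/-- Sum the geometric series `(1 - x ^ (m + 1)) / (1 - x)` and multiply out. A power `x ^ (-r - 1)`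
has Mellin transform `1 / (s - r)`, which gives the partial fractions of `kernelMellin`. -/
theorem gammaSumKernel_eq_sum (α β : ℝ) (m : ℕ) {x : ℝ} (hx : x ∈ Set.Ioo (0 : ℝ) 1) :
    gammaSumKernel α β m x = ∑ k ∈ Finset.range (m + 1), (x ^ (-(α + β - k) - 1) +
      x ^ (-(-k : ℝ) - 1) - x ^ (-(α - k) - 1) - x ^ (-(β - k) - 1)) := by
  have h4 : 1 - x ≠ 0 := (sub_pos.2 hx.2).ne'
  have hx0 := hx.1
  have hg : 1 - x ^ (m + 1) = (∑ k ∈ Finset.range (m + 1), x ^ k) * (1 - x) :=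
    (geom_sum_mul_neg x (m + 1)).symm
  have hα : x ^ α ≠ 0 := (Real.rpow_pos_of_pos hx0 _).ne'
  have hβ : x ^ β ≠ 0 := (Real.rpow_pos_of_pos hx0 _).ne'
  have e : gammaSumKernel α β m x = (∑ k ∈ Finset.range (m + 1), x ^ k) *
      ((1 - x ^ α) * (1 - x ^ β) / (x ^ α * x ^ β * x)) := by
    rw [gammaSumKernel, hg, Real.rpow_add hx0, Real.rpow_add hx0, Real.rpow_one]
    field_simp
  rw [e, Finset.sum_mul]
  refine Finset.sum_congr rfl fun k _ => ?_
  have t1 : -(α + β - k) - 1 = -α + -β + k - 1 := by ring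
  have t2 : -(-k : ℝ) - 1 = k - 1 := by ring
  have t3 : -(α - k) - 1 = -α + k - 1 := by ring
  have t4 : -(β - k) - 1 = -β + k - 1 := by ring
  rw [t1, t2, t3, t4]
  simp only [Real.rpow_sub hx0, Real.rpow_add hx0, Real.rpow_neg hx0.le, Real.rpow_natCast,
    Real.rpow_one]
  field_simp
  ring

theorem integrableOn_cpow_mul_rpow_and_integral {s : ℂ} {r : ℝ} (h : r < s.re) :
    MeasureTheory.IntegrableOn (fun x : ℝ => (x : ℂ) ^ s * (x ^ (-r - 1) : ℝ)) (Set.Ioo 0 1) ∧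
      ∫ x in Set.Ioo (0 : ℝ) 1, (x : ℂ) ^ s * (x ^ (-r - 1) : ℝ) = 1 / (s - r) := by
  have e : Set.EqOn (fun x : ℝ => (x : ℂ) ^ (s - r - 1))
      (fun x : ℝ => (x : ℂ) ^ s * (x ^ (-r - 1) : ℝ)) (Set.Ioo 0 1) := by
    intro x hx
    have hx0 : (x : ℂ) ≠ 0 := by exact_mod_cast hx.1.ne'
    simp only
    rw [Complex.ofReal_cpow hx.1.le, ← Complex.cpow_add _ _ hx0]
    congr 1
    push_cast; ring
  have hre : -1 < (s - r - 1).re := by simp; linarith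
  have hne : s - r ≠ 0 := fun h0 => by
    have := congrArg Complex.re h0
    simp at this
    linarith
  have hi := intervalIntegral.intervalIntegrable_cpow' (a := 0) (b := 1) hre
  rw [intervalIntegrable_iff_integrableOn_Ioo_of_le zero_le_one] at hi
  refine ⟨hi.congr_fun e measurableSet_Ioo, ?_⟩
  rw [← MeasureTheory.setIntegral_congr_fun measurableSet_Ioo e,
    ← MeasureTheory.integral_Ioc_eq_integral_Ioo, ← intervalIntegral.integral_of_le zero_le_one,
    integral_cpow (Or.inl hre)]
  simp [hne]

theorem integrableOn_cpow_mul_gammaSumKernel_and_integral {α β : ℝ} (hα : 0 < α) (hβ : 0 < β)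
    (m : ℕ) {s : ℂ} (hs : α + β < s.re) :
    MeasureTheory.IntegrableOn (fun x : ℝ => (x : ℂ) ^ s * gammaSumKernel α β m x)
        (Set.Ioo 0 1) ∧
      ∫ x in Set.Ioo (0 : ℝ) 1, (x : ℂ) ^ s * gammaSumKernel α β m x = kernelMellin α β m s := by
  have e : Set.EqOn (fun x : ℝ => ∑ k ∈ Finset.range (m + 1),
      ((x : ℂ) ^ s * (x ^ (-(α + β - k) - 1) : ℝ) + (x : ℂ) ^ s * (x ^ (-(-k : ℝ) - 1) : ℝ) -
        (x : ℂ) ^ s * (x ^ (-(α - k) - 1) : ℝ) - (x : ℂ) ^ s * (x ^ (-(β - k) - 1) : ℝ)))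
      (fun x : ℝ => (x : ℂ) ^ s * gammaSumKernel α β m x) (Set.Ioo 0 1) := by
    intro x hx
    simp only
    rw [gammaSumKernel_eq_sum α β m hx, Complex.ofReal_sum, Finset.mul_sum]
    refine Finset.sum_congr rfl fun k _ => ?_
    rw [Complex.ofReal_sub, Complex.ofReal_sub, Complex.ofReal_add]
    ring
  have hk : ∀ k : ℕ, (0 : ℝ) ≤ k := fun k => k.cast_nonneg
  have I := fun (r : ℝ) (h : r ≤ α + β) =>
    integrableOn_cpow_mul_rpow_and_integral (s := s) (r := r) (h.trans_lt hs)
  have I1 := fun k : ℕ => I (α + β - k) (by linarith [hk k])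
  have I2 := fun k : ℕ => I (-k) (by linarith [hk k])
  have I3 := fun k : ℕ => I (α - k) (by linarith [hk k])
  have I4 := fun k : ℕ => I (β - k) (by linarith [hk k])
  set φ : ℝ → ℝ → ℂ := fun r x => (x : ℂ) ^ s * (x ^ (-r - 1) : ℝ)
  have J1 : ∀ k : ℕ, MeasureTheory.IntegrableOn (fun x => φ (α + β - k) x + φ (-k) x)
    (Set.Ioo 0 1) := fun k => (I1 k).1.add (I2 k).1
  have J2 : ∀ k : ℕ, MeasureTheory.IntegrableOn
    (fun x => φ (α + β - k) x + φ (-k) x - φ (α - k) x) (Set.Ioo 0 1) :=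
    fun k => (J1 k).sub (I3 k).1
  have J3 : ∀ k : ℕ, MeasureTheory.IntegrableOn
    (fun x => φ (α + β - k) x + φ (-k) x - φ (α - k) x - φ (β - k) x) (Set.Ioo 0 1) :=
    fun k => (J2 k).sub (I4 k).1
  refine ⟨MeasureTheory.IntegrableOn.congr_fun
    (MeasureTheory.integrable_finsetSum _ fun k _ => J3 k) e measurableSet_Ioo, ?_⟩
  rw [← MeasureTheory.setIntegral_congr_fun measurableSet_Ioo e,
    MeasureTheory.integral_finsetSum _ fun k _ => J3 k, kernelMellin]
  refine Finset.sum_congr rfl fun k _ => ?_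
  rw [MeasureTheory.integral_sub (J2 k) (I4 k).1, MeasureTheory.integral_sub (J1 k) (I3 k).1,
    MeasureTheory.integral_add (I1 k).1 (I2 k).1, (I1 k).2, (I2 k).2, (I3 k).2, (I4 k).2]
  push_cast
  rfl

/-- The kernel is positive, so taking norms only replaces `s` by `Re s`. Fubini then requires decay
of the transform on the real axis alone. -/
theorem integral_norm_cpow_mul_gammaSumKernel {α β : ℝ} (hα : 0 < α) (hβ : 0 < β)
    (m : ℕ) {s : ℂ} (hs : α + β < s.re) :
    ∫ x in Set.Ioo (0 : ℝ) 1, ‖(x : ℂ) ^ s * gammaSumKernel α β m x‖ =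
      ‖kernelMellin α β m s.re‖ := by
  have e : Set.EqOn (fun x : ℝ => ‖(x : ℂ) ^ s * gammaSumKernel α β m x‖)
      (fun x : ℝ => x ^ s.re * gammaSumKernel α β m x) (Set.Ioo 0 1) := by
    intro x hx
    simp only
    rw [norm_mul, Complex.norm_cpow_eq_rpow_re_of_pos hx.1, Complex.norm_real, Real.norm_eq_abs,
      abs_of_pos (gammaSumKernel_pos hα hβ m hx)]
  have h0 : 0 ≤ ∫ x in Set.Ioo (0 : ℝ) 1, x ^ s.re * gammaSumKernel α β m x :=
    MeasureTheory.setIntegral_nonneg measurableSet_Ioo fun x hx =>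
      mul_nonneg (Real.rpow_nonneg hx.1.le _) (gammaSumKernel_pos hα hβ m hx).le
  rw [MeasureTheory.setIntegral_congr_fun measurableSet_Ioo e,
    ← (integrableOn_cpow_mul_gammaSumKernel_and_integral hα hβ m
      (s := (s.re : ℂ)) (by simpa using hs)).2]
  have e2 : ∫ x in Set.Ioo (0 : ℝ) 1, (x : ℂ) ^ (s.re : ℂ) * gammaSumKernel α β m x =
      ((∫ x in Set.Ioo (0 : ℝ) 1, x ^ s.re * gammaSumKernel α β m x : ℝ) : ℂ) := by
    rw [← integral_complex_ofReal]
    refine MeasureTheory.setIntegral_congr_fun measurableSet_Ioo fun x hx => ?_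
    rw [Complex.ofReal_mul, Complex.ofReal_cpow hx.1.le]
  rw [e2, Complex.norm_real, Real.norm_eq_abs, abs_of_nonneg h0]

/-- Interchange of the integral of `g(t) x ^ γ(t) K(x)` along a path `γ` with that over `x`. -/
theorem path_integral_mul_gammaSumKernel {α β : ℝ} (hα : 0 < α) (hβ : 0 < β) (m : ℕ)
    {S : Set ℝ} (hS : MeasurableSet S) {γ g : ℝ → ℂ} (hγ : Continuous γ) (hg : ContinuousOn g S)
    (hre : ∀ t ∈ S, α + β < (γ t).re)
    (hint : MeasureTheory.IntegrableOn (fun t => ‖g t‖ * ‖kernelMellin α β m (γ t).re‖) S) :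
    (∀ᵐ x : ℝ ∂(MeasureTheory.volume.restrict (Set.Ioo (0 : ℝ) 1)),
      MeasureTheory.IntegrableOn (fun t => g t * (x : ℂ) ^ γ t) S) ∧
    MeasureTheory.IntegrableOn
      (fun x : ℝ => (∫ t in S, g t * (x : ℂ) ^ γ t) * gammaSumKernel α β m x) (Set.Ioo 0 1) ∧
    ∫ x in Set.Ioo (0 : ℝ) 1, (∫ t in S, g t * (x : ℂ) ^ γ t) * gammaSumKernel α β m x =
      ∫ t in S, g t * kernelMellin α β m (γ t) := by
  set Φ : ℝ × ℝ → ℂ := fun z => g z.1 * ((z.2 : ℂ) ^ γ z.1 * gammaSumKernel α β m z.2)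
  have hmeas : MeasureTheory.AEStronglyMeasurable Φ ((MeasureTheory.volume.restrict S).prod
      (MeasureTheory.volume.restrict (Set.Ioo (0 : ℝ) 1))) := by
    rw [MeasureTheory.Measure.prod_restrict]
    refine ContinuousOn.aestronglyMeasurable ?_ (hS.prod measurableSet_Ioo)
    have c1 : ContinuousOn (fun z : ℝ × ℝ => g z.1) (S ×ˢ Set.Ioo 0 1) :=
      hg.comp continuousOn_fst fun z hz => hz.1
    have c2 : ContinuousOn (fun z : ℝ × ℝ => (z.2 : ℂ) ^ γ z.1) (S ×ˢ Set.Ioo 0 1) := by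
      refine ContinuousOn.cpow (by fun_prop) (by fun_prop) fun z hz => ?_
      left; simpa using hz.2.1
    have c3 : ContinuousOn (gammaSumKernel α β m) (Set.Ioo 0 1) := by
      have hp : ∀ r : ℝ, ContinuousOn (fun x : ℝ => x ^ r) (Set.Ioo 0 1) := fun r x hx =>
        (Real.continuousAt_rpow_const x r (Or.inl hx.1.ne')).continuousWithinAt
      refine ContinuousOn.div (((by fun_prop : ContinuousOn _ _).mul
        (continuousOn_const.sub (hp α))).mul (continuousOn_const.sub (hp β)))
        ((hp _).mul (by fun_prop)) fun x hx => ?_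
      exact mul_ne_zero (Real.rpow_pos_of_pos hx.1 _).ne' (sub_pos.2 hx.2).ne'
    have c4 : ContinuousOn (fun z : ℝ × ℝ => ((gammaSumKernel α β m z.2 : ℝ) : ℂ))
        (S ×ˢ Set.Ioo 0 1) :=
      Complex.continuous_ofReal.comp_continuousOn (c3.comp continuousOn_snd fun z hz => hz.2)
    exact c1.mul (c2.mul c4)
  have hΦ : MeasureTheory.Integrable Φ ((MeasureTheory.volume.restrict S).prod
      (MeasureTheory.volume.restrict (Set.Ioo (0 : ℝ) 1))) := by
    rw [MeasureTheory.integrable_prod_iff hmeas]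
    constructor
    · refine (MeasureTheory.ae_restrict_iff' hS).2 (.of_forall fun t ht => ?_)
      exact (integrableOn_cpow_mul_gammaSumKernel_and_integral hα hβ m (hre t ht)).1.const_mul
        (g t)
    · refine MeasureTheory.IntegrableOn.congr_fun hint (fun t ht => ?_) hS
      simp only [Φ]
      rw [← integral_norm_cpow_mul_gammaSumKernel hα hβ m (hre t ht),
        ← MeasureTheory.integral_const_mul]
      simp only [norm_mul]
  have hfac : ∀ x : ℝ, (∫ t in S, Φ (t, x)) =
      (∫ t in S, g t * (x : ℂ) ^ γ t) * gammaSumKernel α β m x := by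
    intro x
    rw [← MeasureTheory.integral_mul_const]
    simp only [Φ, mul_assoc]
  refine ⟨?_, ?_, ?_⟩
  -- Fubini gives integrability along the path with the kernel as a factor; being positive, it can
  -- be divided out.
  · filter_upwards [hΦ.prod_left_ae, MeasureTheory.ae_restrict_mem measurableSet_Ioo] with x hx hm
    have hK : ((gammaSumKernel α β m x : ℝ) : ℂ) ≠ 0 := by
      exact_mod_cast (gammaSumKernel_pos hα hβ m hm).ne'
    have := hx.mul_const ((gammaSumKernel α β m x : ℝ) : ℂ)⁻¹
    refine this.congr (.of_forall fun t => ?_)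
    simp only [Φ]
    field_simp
  · simpa only [hfac, MeasureTheory.IntegrableOn] using hΦ.integral_prod_right
  · simp only [← hfac]
    rw [← MeasureTheory.integral_integral_swap (f := fun t x => Φ (t, x)) hΦ]
    refine MeasureTheory.setIntegral_congr_fun hS fun t ht => ?_
    simp only [Φ]
    rw [MeasureTheory.integral_const_mul,
      (integrableOn_cpow_mul_gammaSumKernel_and_integral hα hβ m (hre t ht)).2]

/-! ### Meijer's function, change of loop and conclusion -/

theorem meijerIntegrand_eq_gammaQuotient_mul_cpow {p : ℕ} (a b : Fin p → ℂ) (α β : ℝ) (m : ℕ)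
    (z s : ℂ) :
    meijerIntegrand (fun j => 1 - a j - m) (fun j => b j + α + β) (fun j => a j + α + β)
      (fun j => 1 - b j - m) z s = gammaQuotient a b (α + β) m s * z ^ s := by
  have e1 : ∀ w : ℂ, 1 - (1 - w - m) + s = w + ((m : ℝ) + s) := fun w => by push_cast; ring
  have e2 : ∀ w : ℂ, w + α + β - s = w + ((α + β : ℝ) - s) := fun w => by push_cast; ring
  simp only [meijerIntegrand, gammaQuotient, gammaProd, e1, e2]

/-- The loop integral does not depend on the abscissa of the vertical side. -/
theorem loopIntegral_eq_of_differentiableAt {f : ℂ → ℂ} {c₁ c₂ T : ℝ} (hT : 0 ≤ T)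
    (hd : ∀ s : ℂ, s.re ∈ Set.uIcc c₁ c₂ → |s.im| ≤ T → DifferentiableAt ℂ f s)
    (h₁ : MeasureTheory.IntegrableOn (fun σ : ℝ => f (σ - T * Complex.I)) (Set.Ioi c₂))
    (h₂ : MeasureTheory.IntegrableOn (fun σ : ℝ => f (σ + T * Complex.I)) (Set.Ioi c₂)) :
    loopIntegral f c₁ T = loopIntegral f c₂ T := by
  obtain ⟨⟨i1, i2, -, -⟩, hrect⟩ := HasRectIntegral.of_differentiableOn (f := f) (x₀ := c₁)
    (x₁ := c₂) (y₀ := -T) (y₁ := T) fun s hs => by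
      rw [Complex.mem_reProdIm, Set.uIcc_of_le (a := -T) (by linarith)] at hs
      exact (hd s hs.1 (abs_le.2 hs.2)).differentiableWithinAt
  simp only [Complex.ofReal_neg, neg_mul, ← sub_eq_add_neg] at i1 hrect
  rw [loopIntegral, loopIntegral, ← intervalIntegral.integral_interval_add_Ioi' i1 h₁,
    ← intervalIntegral.integral_interval_add_Ioi' i2 h₂]
  linear_combination -hrect

/-- On the ray `|σ + iy|` is comparable to `σ`, so the product is `O(σ ^ (e - 3))`, and `e < 2` by
`hab`. -/
theorem integrableOn_ray_norm_gammaQuotient_mul_norm_kernelMellin {p : ℕ} {a b : Fin p → ℂ}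
    {α β : ℝ} (m : ℕ) (hα : 0 < α) (hβ : 0 < β) (hab : (∑ j, a j).re < (∑ j, b j).re + 1)
    {c y : ℝ} (hc : α + β < c) (hy : 0 < |y|) (hay : ∀ j, |(a j).im| < |y|) :
    MeasureTheory.IntegrableOn (fun σ : ℝ => ‖gammaQuotient a b (α + β) m (σ + y * Complex.I)‖ *
      ‖kernelMellin α β m σ‖) (Set.Ioi c) := by
  obtain ⟨C₁, h₁, H₁⟩ := exists_norm_gammaQuotient_le a b (α + β) m hy hay
  obtain ⟨C₂, h₂, H₂⟩ := exists_norm_kernelMellin_le_of_le hα hβ m hc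
  have hc0 : 0 < c := by linarith
  set e := 2 * ((∑ j, a j).re - (∑ j, b j).re) with he
  have hM : 0 < 1 + |y| / c := by positivity
  refine MeasureTheory.Integrable.mono'
    (((integrableOn_Ioi_rpow_of_lt (by linarith : e + -3 < -1) hc0)).const_mul
      (C₁ * (1 + |y| / c) ^ |e| * C₂)) ?_ ?_
  · refine ContinuousOn.aestronglyMeasurable (fun σ hσ => ?_) measurableSet_Ioi
    have hσ' : c < σ := hσ
    have d1 : DifferentiableAt ℂ (gammaQuotient a b (α + β) m) (σ + y * Complex.I) :=
      differentiableAt_gammaQuotient fun j => Or.inl (by simpa using hay j)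
    have d2 : DifferentiableAt ℂ (kernelMellin α β m) σ :=
      differentiableAt_kernelMellin (fun r _ hr h => by
        rw [Complex.ofReal_inj] at h; linarith) hα hβ
    have c1 := ContinuousAt.comp (f := fun σ : ℝ => (σ : ℂ) + y * Complex.I) d1.continuousAt
      (by fun_prop)
    have c2 := ContinuousAt.comp (f := fun σ : ℝ => (σ : ℂ)) d2.continuousAt (by fun_prop)
    exact (c1.norm.mul c2.norm).continuousWithinAt
  · refine (MeasureTheory.ae_restrict_iff' measurableSet_Ioi).2 (.of_forall fun σ hσ => ?_)
    have hσ' : c < σ := hσ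
    have hσ0 : 0 < σ := hc0.trans hσ'
    have him : |((σ : ℂ) + y * Complex.I).im| = |y| := by simp
    have n1 : σ ≤ ‖(σ : ℂ) + y * Complex.I‖ := by
      refine le_trans ?_ (Complex.abs_re_le_norm _)
      simpa using le_abs_self σ
    have n2 : ‖(σ : ℂ) + y * Complex.I‖ ≤ (1 + |y| / c) * σ := by
      have h3 : ‖(σ : ℂ) + y * Complex.I‖ ≤ σ + |y| := by
        refine (norm_add_le _ _).trans (le_of_eq ?_)
        rw [norm_mul, Complex.norm_I, mul_one, Complex.norm_real, Complex.norm_real,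
          Real.norm_eq_abs, Real.norm_eq_abs, abs_of_pos hσ0]
      have h4 : |y| ≤ |y| / c * σ := by
        rw [div_mul_eq_mul_div, le_div_iff₀ hc0]; gcongr
      linarith
    have n3 := Real.rpow_le_mul_rpow_of_le_mul (hσ0.trans_le n1) hσ0 hM n2
      (n1.trans (le_mul_of_one_le_left (norm_nonneg _) (le_add_of_nonneg_right (by positivity)))) e
    have b1 := (H₁ _ him.ge).trans (mul_le_mul_of_nonneg_left n3 h₁)
    rw [norm_mul, norm_norm, norm_norm]
    refine (mul_le_mul b1 (H₂ σ hσ'.le) (norm_nonneg _) (by positivity)).trans (le_of_eq ?_)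
    rw [Real.rpow_add hσ0]
    ring

theorem mainTheorem5 (p : ℕ) (a b : Fin p → ℂ) (α β : ℝ) (m : ℕ)
    (ha : ∀ j, 0 < (a j).re) (hab : (∑ j, a j).re < (∑ j, b j).re + 1)
    (hα : 0 < α) (hβ : 0 < β) :
    MeasureTheory.IntegrableOn (gammaSumIntegrand a b α β m) (Set.Ioo 0 1) ∧
    ∑ k ∈ Finset.range (m + 1),
      (gammaProd a k * gammaProd a (α + β + m - k) / (gammaProd b k * gammaProd b (α + β + m - k)) -
        gammaProd a (α + k) * gammaProd a (β + m - k) /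
          (gammaProd b (α + k) * gammaProd b (β + m - k))) =
      ∫ x in Set.Ioo (0 : ℝ) 1, gammaSumIntegrand a b α β m x := by
  have hm : (0 : ℝ) ≤ m := m.cast_nonneg
  -- A filter argument in place of a minimum also covers `p = 0`.
  obtain ⟨d, had, hd⟩ : ∃ d : ℝ, (∀ j, d < (a j).re) ∧ 0 < d :=
    ((eventually_all.2 fun j => (eventually_lt_nhds (ha j)).filter_mono
      nhdsWithin_le_nhds).and (self_mem_nhdsWithin : Set.Ioi (0 : ℝ) ∈ 𝓝[>] 0)).exists
  -- A separating loop exists, so `meijerG` does not take its junk value.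
  have hex : ∃ L : ℝ × ℝ, IsSeparatingLoop (fun j => 1 - a j - m) (fun j => a j + α + β)
      L.1 L.2 := by
    refine ⟨(α + β, 1 + ∑ j, |(a j).im|), by positivity, fun j => ⟨?_, ?_⟩, fun j => ?_⟩
    · simp; linarith [ha j]
    · have := Finset.single_le_sum (f := fun j => |(a j).im|) (fun j _ => abs_nonneg _)
        (Finset.mem_univ j)
      simp; linarith
    · simp; linarith [ha j]
  obtain ⟨hT, hsep₁, hsep₂⟩ := hex.choose_spec
  set c₁ := hex.choose.1
  set T := hex.choose.2
  set F := gammaQuotient a b (α + β) m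
  have haT : ∀ j, |(a j).im| < T := fun j => by simpa using (hsep₁ j).2
  have hc₁ : ∀ j, c₁ < α + β + (a j).re ∧ -(m + (a j).re) < c₁ := fun j => by
    have h1 := (hsep₁ j).1
    have h2 := hsep₂ j
    simp at h1 h2
    constructor <;> linarith
  -- The chosen abscissa `c₁` is only known to separate the poles and may be at most `α + β`, where
  -- the Mellin integral need not converge. The vertical side is therefore moved to `c`, with the
  -- same `T`.
  set c := α + β + d with hcdef
  have hc : α + β < c := by linarith
  have hF : ∀ s : ℂ, s.re ∈ Set.uIcc c₁ c → DifferentiableAt ℂ F s := fun s hs =>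
    differentiableAt_gammaQuotient fun j => Or.inr (by
      rcases Set.mem_uIcc.1 hs with h | h
      · constructor
        · linarith [had j]
        · linarith [(hc₁ j).2]
      · constructor
        · linarith [(hc₁ j).1]
        · linarith [ha j])
  have hray : ∀ y : ℝ, |y| = T → Continuous (fun σ : ℝ => (σ : ℂ) + y * Complex.I) ∧
      ContinuousOn (fun σ : ℝ => F (σ + y * Complex.I)) (Set.Ioi c) ∧
      (∀ σ ∈ Set.Ioi c, α + β < ((σ : ℂ) + y * Complex.I).re) ∧
      MeasureTheory.IntegrableOn (fun σ : ℝ => ‖F (σ + y * Complex.I)‖ *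
        ‖kernelMellin α β m ((σ : ℂ) + y * Complex.I).re‖) (Set.Ioi c) := by
    intro y hy
    refine ⟨by fun_prop, fun σ hσ => ?_, fun σ hσ => ?_, ?_⟩
    · have d1 : DifferentiableAt ℂ F (σ + y * Complex.I) :=
        differentiableAt_gammaQuotient fun j => Or.inl (by simpa [hy] using haT j)
      exact (ContinuousAt.comp (f := fun σ : ℝ => (σ : ℂ) + y * Complex.I) d1.continuousAt
        (by fun_prop)).continuousWithinAt
    · have : c < σ := hσ
      simp; linarith
    · have := integrableOn_ray_norm_gammaQuotient_mul_norm_kernelMellin (b := b) m hα hβ hab hc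
        (y := y) (by rwa [hy]) (by rwa [hy])
      simpa using this
  obtain ⟨r1, r2, r3, r4⟩ := hray (-T) (by rw [abs_neg, abs_of_pos hT])
  simp only [Complex.ofReal_neg, neg_mul, ← sub_eq_add_neg] at r1 r2 r3 r4
  obtain ⟨t1, t2, t3, t4⟩ := hray T (abs_of_pos hT)
  obtain ⟨A1, A2, A3⟩ := path_integral_mul_gammaSumKernel hα hβ m measurableSet_Ioi r1 r2 r3 r4
  obtain ⟨B1, B2, B3⟩ := path_integral_mul_gammaSumKernel hα hβ m measurableSet_Ioi t1 t2 t3 t4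
  have hvert : Continuous (fun t : ℝ => F (c + t * Complex.I)) :=
    continuous_iff_continuousAt.2 fun t =>
      ContinuousAt.comp (f := fun t : ℝ => (c : ℂ) + t * Complex.I)
        (hF _ (by simp)).continuousAt (by fun_prop)
  obtain ⟨-, V2, V3⟩ := path_integral_mul_gammaSumKernel hα hβ m (S := Set.Ioc (-T) T)
    measurableSet_Ioc (γ := fun t : ℝ => (c : ℂ) + t * Complex.I) (by fun_prop)
    hvert.continuousOn (fun t _ => by simpa using hc) (by
      have : ∀ t : ℝ, ((c : ℂ) + t * Complex.I).re = c := fun t => by simp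
      simp only [this]
      exact ((hvert.norm.mul continuous_const).integrableOn_Icc).mono_set Set.Ioc_subset_Icc_self)
  simp only [← intervalIntegral.integral_of_le (by linarith : -T ≤ T)] at V2 V3
  -- Equality holds almost everywhere: moving the loop uses convergence along the rays, which Fubini
  -- supplies for almost every `x`.
  have hG : gammaSumIntegrand a b α β m =ᵐ[MeasureTheory.volume.restrict (Set.Ioo 0 1)]
      fun x : ℝ => (2 * (Real.pi : ℂ) * Complex.I)⁻¹ *
        (-((∫ σ in Set.Ioi c, F (σ - T * Complex.I) * (x : ℂ) ^ (σ - T * Complex.I)) *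
            gammaSumKernel α β m x) +
          Complex.I * ((∫ t in (-T)..T, F (c + t * Complex.I) * (x : ℂ) ^ (c + t * Complex.I)) *
            gammaSumKernel α β m x) +
          (∫ σ in Set.Ioi c, F (σ + T * Complex.I) * (x : ℂ) ^ (σ + T * Complex.I)) *
            gammaSumKernel α β m x) := by
    filter_upwards [A1, B1, MeasureTheory.ae_restrict_mem measurableSet_Ioo] with x hA hB hx
    have hx0 : (x : ℂ) ≠ 0 := by exact_mod_cast hx.1.ne'
    have hloop := loopIntegral_eq_of_differentiableAt (f := fun s => F s * (x : ℂ) ^ s)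
      (c₁ := c₁) (c₂ := c) hT.le (fun s hs _ => (hF s hs).mul
        (differentiableAt_id.const_cpow (Or.inl hx0))) hA hB
    rw [gammaSumIntegrand, meijerG, dif_pos hex]
    simp only [funext (meijerIntegrand_eq_gammaQuotient_mul_cpow a b α β m x)]
    rw [hloop, loopIntegral, ← gammaSumKernel]
    ring
  have hn : MeasureTheory.IntegrableOn
      (fun x : ℝ => -((∫ σ in Set.Ioi c, F (σ - T * Complex.I) * (x : ℂ) ^ (σ - T * Complex.I)) *
        gammaSumKernel α β m x)) (Set.Ioo 0 1) := A2.neg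
  have hnv := MeasureTheory.Integrable.fun_add hn (V2.const_mul Complex.I)
  have hint := MeasureTheory.Integrable.fun_add hnv B2
  refine ⟨(hint.const_mul _).congr hG.symm, ?_⟩
  rw [MeasureTheory.integral_congr_ae hG, MeasureTheory.integral_const_mul,
    MeasureTheory.integral_add hnv B2,
    MeasureTheory.integral_add hn (V2.const_mul Complex.I), MeasureTheory.integral_neg,
    MeasureTheory.integral_const_mul, A3, V3, B3]
  have := loopIntegral_gammaQuotientMulKernel m hα hβ hab hd had hT haT
  have hpi : (2 * (Real.pi : ℂ) * Complex.I) ≠ 0 := Complex.two_pi_I_ne_zero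
  rw [eq_inv_mul_iff_mul_eq₀ hpi]
  exact this.symm
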